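/- Theorem 5.2 (Sobolev-Pa). Let $\mathbb T=\mathbb R/2\pi\mathbb Z$. For $f\in L^2(\mathbb R\times\mathbb T)$ let $$\mathcal F f(\xi,j)=\int_{\mathbb R}\int_{\mathbb T} f(x,\theta)\,e^{-i(x\xi+j\theta)}\,d\theta\,dx,\qquad (\xi,j)\in\mathbb R\times\mathbb Z,$$ be its Fourier transform, understood in the $L^2$ sense; it is an isomorphism of $L^2(\mathbb R\times\mathbb T)$ onto $L^2(\mathbb R\times\mathbb Z)$. For a bounded measurable function $m$ on $\mathbb R\times\mathbb Z$ let $T_m f=\mathcal F^{-1}(m\,\mathcal F f)$ be the associated Fourier multiplier operator on $L^2(\mathbb R\times\mathbb T)$. Let $\mathcal C_2:L^2((0,\infty)\times\mathbb T)\to L^2(\mathbb R\times\mathbb T)$ be the surjective isometry $$(\mathcal C_2\varphi)(x,\theta)=e^{x/2}\varphi(e^x,\theta),$$ and let $\chi_+$ denote multiplication by the characteristic function of $(0,\infty)$ in the first variable (functions on $(0,\infty)\times\mathbb T$ being identified with functions on $\mathbb R\times\mathbb T$ that vanish for $x\le 0$). For real $a$ with $|a|\ge\pi$ put $$m_a(\xi)=\frac{e^{a\xi}}{2\cosh(a\xi)},\qquad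 P_a=\chi_+\,\mathcal C_2^{-1}\,T_{m_a}\,\mathcal C_2\,\chi_+ ,$$ a bounded operator on $L^2(\mathbb R\times\mathbb T)$. For $s\ge 0$ let $W^{s,2}(\mathbb R\times\mathbb T)$ be the space of all $f\in L^2(\mathbb R\times\mathbb T)$ such that $(1+\xi^2+j^2)^{s/2}\mathcal F f\in L^2(\mathbb R\times\mathbb Z)$, with the norm $$\|f\|_{W^{s,2}}=\big\|\mathcal F^{-1}\big[(1+\xi^2+j^2)^{s/2}\mathcal F f\big]\big\|_{L^2(\mathbb R\times\mathbb T)}.$$ Then for every $a$ with $|a|\ge\pi$ and every $s\in\big[0,\tfrac{\pi}{2|a|}\big)$ the operator $P_a$ maps $W^{s,2}(\mathbb R\times\mathbb T)$ into itself and defines a bounded linear operator $P_a:W^{s,2}(\mathbb R\times\mathbb T)\to W^{s,2}(\mathbb R\times\mathbb T)$. -/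

import Mathlib

namespace MellinFourier

noncomputable section

open MeasureTheory Real Set Filter Topology
open scoped ENNReal FourierTransform

instance factTwoPiPos : Fact (0 < 2 * π) := ⟨Real.two_pi_pos⟩

/-! ### The spaces -/

/-- The circle `𝕋`, with `2π`-periodic angle `θ`, characters `θ ↦ exp (i j θ)` for `j : ℤ`, and
Lebesgue measure `dθ` of total mass `2π`. -/
abbrev Torus : Type := AddCircle (2 * π)

/-- `L²(ℝ × 𝕋)` with respect to `dx dθ`. -/
abbrev L2RT : Type := Lp ℂ 2 (volume : Measure (ℝ × Torus))

/-- Lebesgue measure times counting measure on the dual group `ℝ × ℤ` of `ℝ × 𝕋`. -/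
abbrev dualMeasure : Measure (ℝ × ℤ) := (volume : Measure ℝ).prod Measure.count

/-- `L²(ℝ × ℤ)`. -/
abbrev L2RZ : Type := Lp ℂ 2 dualMeasure

/-- Lebesgue measure on the half cylinder `(0, ∞) × 𝕋`. -/
abbrev halfMeasure : Measure (ℝ × Torus) := volume.restrict (Ioi (0 : ℝ) ×ˢ univ)

/-- `L²((0, ∞) × 𝕋)`. -/
abbrev L2Half : Type := Lp ℂ 2 halfMeasure

/-! ### Isometries of the form `f ↦ w · (f ∘ φ)` -/

section WeightedComposition

variable {α β : Type*} [MeasurableSpace α] [MeasurableSpace β] {μ : Measure α} {ν : Measure β}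

theorem ae_weighted_comp {w : β → ℂ} {φ : β → α} (hw : Measurable w) (hφ : Measurable φ)
    (hn : ∀ g : α → ℝ≥0∞, Measurable g → ∫⁻ y, ‖w y‖ₑ ^ 2 * g (φ y) ∂ν = ∫⁻ x, g x ∂μ)
    {P : α → Prop} (hP : ∀ᵐ x ∂μ, P x) : ∀ᵐ y ∂ν, w y = 0 ∨ P (φ y) := by
  have hN : MeasurableSet (toMeasurable μ {x | ¬ P x}) := measurableSet_toMeasurable _ _
  have h0 := hn ((toMeasurable μ {x | ¬ P x}).indicator 1) (measurable_one.indicator hN)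
  rw [lintegral_indicator_one hN, measure_toMeasurable, ae_iff.mp hP,
    lintegral_eq_zero_iff (by fun_prop (disch := exact hN))] at h0
  filter_upwards [h0] with y hy
  by_contra! hc
  have hm : φ y ∈ toMeasurable μ {x | ¬ P x} := subset_toMeasurable _ _ hc.2
  simp [hm, hc.1] at hy

theorem eLpNorm_weighted_comp {w : β → ℂ} {φ : β → α}
    (hn : ∀ g : α → ℝ≥0∞, Measurable g → ∫⁻ y, ‖w y‖ₑ ^ 2 * g (φ y) ∂ν = ∫⁻ x, g x ∂μ)
    {f : α → ℂ} (hf : StronglyMeasurable f) :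
    eLpNorm (fun y => w y * f (φ y)) 2 ν = eLpNorm f 2 μ := by
  rw [eLpNorm_eq_lintegral_rpow_enorm_toReal (by norm_num) (by norm_num),
    eLpNorm_eq_lintegral_rpow_enorm_toReal (by norm_num) (by norm_num)]
  congr 1
  have := hn (fun x => ‖f x‖ₑ ^ 2) (by have := hf.measurable; fun_prop)
  simpa [enorm_mul, mul_pow] using this

theorem memLp_weighted_comp {w : β → ℂ} {φ : β → α} (hw : Measurable w) (hφ : Measurable φ)
    (hn : ∀ g : α → ℝ≥0∞, Measurable g → ∫⁻ y, ‖w y‖ₑ ^ 2 * g (φ y) ∂ν = ∫⁻ x, g x ∂μ)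
    (f : Lp ℂ 2 μ) : MemLp (fun y => w y * f (φ y)) 2 ν :=
  ⟨(hw.mul ((Lp.stronglyMeasurable f).measurable.comp hφ)).aestronglyMeasurable, by
    rw [eLpNorm_weighted_comp hn (Lp.stronglyMeasurable f)]; exact Lp.eLpNorm_lt_top f⟩

/-- The isometry `f ↦ w · (f ∘ φ)` of `L²` spaces attached to a weight `w` and a map `φ` for which
`|w|²` times the target measure is carried by `φ` to the source measure. -/
def weightedComp (w : β → ℂ) (φ : β → α) (hw : Measurable w) (hφ : Measurable φ)
    (hn : ∀ g : α → ℝ≥0∞, Measurable g → ∫⁻ y, ‖w y‖ₑ ^ 2 * g (φ y) ∂ν = ∫⁻ x, g x ∂μ) :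
    Lp ℂ 2 μ →ₗᵢ[ℂ] Lp ℂ 2 ν where
  toFun f := (memLp_weighted_comp hw hφ hn f).toLp (fun y => w y * f (φ y))
  map_add' f g := by
    rw [← MemLp.toLp_add, MemLp.toLp_eq_toLp_iff]
    filter_upwards [ae_weighted_comp hw hφ hn (Lp.coeFn_add f g)] with y hy
    rcases hy with hy | hy
    · simp [hy]
    · simp only [hy, Pi.add_apply, mul_add]
  map_smul' c f := by
    rw [RingHom.id_apply, ← MemLp.toLp_const_smul, MemLp.toLp_eq_toLp_iff]
    filter_upwards [ae_weighted_comp hw hφ hn (Lp.coeFn_smul c f)] with y hy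
    rcases hy with hy | hy
    · simp [hy]
    · simp [hy]; ring
  norm_map' f := (Lp.norm_toLp _ (memLp_weighted_comp hw hφ hn f)).trans <| by
    rw [eLpNorm_weighted_comp hn (Lp.stronglyMeasurable f), Lp.norm_def]

theorem weightedComp_coeFn (w : β → ℂ) (φ : β → α) (hw : Measurable w) (hφ : Measurable φ)
    (hn : ∀ g : α → ℝ≥0∞, Measurable g → ∫⁻ y, ‖w y‖ₑ ^ 2 * g (φ y) ∂ν = ∫⁻ x, g x ∂μ)
    (f : Lp ℂ 2 μ) : weightedComp w φ hw hφ hn f =ᵐ[ν] fun y => w y * f (φ y) :=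
  MemLp.coeFn_toLp (memLp_weighted_comp hw hφ hn f)

end WeightedComposition

/-! ### Restriction to, and extension by zero from, the half cylinder -/

theorem measurableSet_half : MeasurableSet (Ioi (0 : ℝ) ×ˢ (univ : Set Torus)) :=
  measurableSet_Ioi.prod .univ

/-- Multiplication by `χ₊(x)`, the result being viewed as a function on `(0, ∞) × 𝕋`:
`f ↦ f|_{(0, ∞) × 𝕋}`. -/
def restrictPos : L2RT →L[ℂ] L2Half :=
  LpToLpRestrictCLM (ℝ × Torus) ℂ ℂ volume 2 (Ioi (0 : ℝ) ×ˢ univ)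

/-- A function on `(0, ∞) × 𝕋` multiplied by `χ₊(x)` and so viewed as a function on `ℝ × 𝕋`:
extension by zero. -/
def extendPos : L2Half →ₗᵢ[ℂ] L2RT :=
  weightedComp ((Ioi (0 : ℝ) ×ˢ univ).indicator 1) id (measurable_one.indicator measurableSet_half)
    measurable_id (fun g hg => by
      rw [← lintegral_indicator measurableSet_half]
      congr 1; ext p
      by_cases hp : p ∈ Ioi (0 : ℝ) ×ˢ (univ : Set Torus) <;> simp only [indicator, hp] <;> simp)

/-! ### The operator `𝒞₂` -/

theorem halfMeasure_eq :
    halfMeasure = (volume.restrict (Ioi (0 : ℝ))).prod (volume : Measure Torus) := by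
  rw [halfMeasure, Measure.volume_eq_prod, ← Measure.prod_restrict, Measure.restrict_univ]

theorem lintegral_exp_change (g : ℝ → ℝ≥0∞) :
    ∫⁻ t in Ioi (0 : ℝ), g t = ∫⁻ x, ENNReal.ofReal (exp x) * g (exp x) := by
  have := lintegral_image_eq_lintegral_abs_deriv_mul (s := univ) MeasurableSet.univ
    (fun x _ => (Real.hasDerivAt_exp x).hasDerivWithinAt) Real.exp_injective.injOn g
  simpa [Real.range_exp, abs_of_pos (Real.exp_pos _)] using this

theorem enorm_exp_half (x : ℝ) : ‖((exp (x / 2) : ℝ) : ℂ)‖ₑ ^ 2 = ENNReal.ofReal (exp x) := by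
  rw [← ofReal_norm, ← ENNReal.ofReal_pow (norm_nonneg _), Complex.norm_real, Real.norm_eq_abs,
    sq_abs, sq, ← Real.exp_add, add_halves]

theorem lintegral_logChange (g : ℝ × Torus → ℝ≥0∞) (hg : Measurable g) :
    ∫⁻ p : ℝ × Torus, ‖((exp (p.1 / 2) : ℝ) : ℂ)‖ₑ ^ 2 * g (exp p.1, p.2) =
      ∫⁻ p, g p ∂halfMeasure := by
  rw [halfMeasure_eq, Measure.volume_eq_prod, lintegral_prod_symm' _ hg,
    lintegral_prod_symm' _ (by fun_prop)]
  congr 1; ext θ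
  rw [lintegral_exp_change]
  simp_rw [enorm_exp_half]

theorem lintegral_expChange (g : ℝ × Torus → ℝ≥0∞) (hg : Measurable g) :
    ∫⁻ p, ‖((exp (- log p.1 / 2) : ℝ) : ℂ)‖ₑ ^ 2 * g (log p.1, p.2) ∂halfMeasure = ∫⁻ p, g p := by
  rw [← lintegral_logChange _ (by fun_prop)]
  congr 1; ext p
  rw [enorm_exp_half, enorm_exp_half, log_exp, ← mul_assoc, ← ENNReal.ofReal_mul (exp_pos _).le,
    ← exp_add]
  simp

/-- `(𝒞₂ φ)(x, θ) = e^{x/2} φ(e^x, θ)`, an isometry. -/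
def logChange : L2Half →ₗᵢ[ℂ] L2RT :=
  weightedComp (fun p => ((exp (p.1 / 2) : ℝ) : ℂ)) (fun p => (exp p.1, p.2)) (by fun_prop)
    (by fun_prop) lintegral_logChange

/-- `g ↦ t^{-1/2} g(log t, θ)`, written with `t^{-1/2} = exp (-(log t)/2)` for `t > 0`. -/
def logChangeInv : L2RT →ₗᵢ[ℂ] L2Half :=
  weightedComp (fun p => ((exp (-log p.1 / 2) : ℝ) : ℂ)) (fun p => (log p.1, p.2)) (by fun_prop)
    (by fun_prop) lintegral_expChange

theorem logChange_logChangeInv (g : L2RT) : logChange (logChangeInv g) = g := by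
  apply Lp.ext
  have h1 := weightedComp_coeFn _ _ (by fun_prop) (by fun_prop) lintegral_logChange (logChangeInv g)
  have h2 := ae_weighted_comp (by fun_prop) (by fun_prop) lintegral_logChange
    (weightedComp_coeFn _ _ (by fun_prop) (by fun_prop) lintegral_expChange g)
  filter_upwards [h1, h2] with p hp1 hp2
  refine hp1.trans ?_
  rcases hp2 with hp2 | hp2
  · simp at hp2
  · change logChangeInv g _ = _ at hp2
    rw [hp2, log_exp, ← mul_assoc, ← Complex.ofReal_mul, ← exp_add]
    simp [neg_div]

/-- The isometry `𝒞₂` of `L²((0, ∞) × 𝕋)` onto `L²(ℝ × 𝕋)`,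
`(𝒞₂ φ)(x, θ) = e^{x/2} φ(e^x, θ)`. -/
def C2 : L2Half ≃ₗᵢ[ℂ] L2RT :=
  LinearIsometryEquiv.ofSurjective logChange fun g => ⟨logChangeInv g, logChange_logChangeInv g⟩

theorem C2_coeFn (f : L2Half) :
    C2 f =ᵐ[volume] fun p => ((exp (p.1 / 2) : ℝ) : ℂ) * f (exp p.1, p.2) :=
  weightedComp_coeFn _ _ (by fun_prop) (by fun_prop) lintegral_logChange f

theorem C2_symm_coeFn (g : L2RT) :
    C2.symm g =ᵐ[halfMeasure] fun p => ((exp (-log p.1 / 2) : ℝ) : ℂ) * g (log p.1, p.2) := by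
  have h : C2.symm g = logChangeInv g :=
    (LinearIsometryEquiv.symm_apply_eq C2).2 (logChange_logChangeInv g).symm
  rw [h]
  exact weightedComp_coeFn _ _ (by fun_prop) (by fun_prop) lintegral_expChange g

/-! ### The Fourier transform on `L²(ℝ × 𝕋)` -/

theorem ae_dual_iff {P : ℝ × ℤ → Prop} :
    (∀ᵐ p ∂dualMeasure, P p) ↔ ∀ j : ℤ, ∀ᵐ x : ℝ, P (x, j) := by
  have hslice : ∀ (N : Set ℝ) (j : ℤ), dualMeasure (N ×ˢ {j}) = volume N := fun N j => by
    rw [dualMeasure, Measure.prod_prod, Measure.count_singleton, mul_one]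
  constructor
  · intro h j
    rw [ae_iff] at h ⊢
    rw [← hslice _ j]
    refine measure_mono_null ?_ h
    rintro ⟨x, k⟩ ⟨hx, hk⟩
    simp only [mem_singleton_iff] at hk
    subst hk
    exact hx
  · intro h
    rw [ae_iff]
    refine measure_mono_null (t := ⋃ j : ℤ, {x | ¬ P (x, j)} ×ˢ {j}) ?_ ?_
    · rintro ⟨x, k⟩ hx
      exact mem_iUnion.2 ⟨k, hx, rfl⟩
    · rw [measure_iUnion_null_iff]
      intro j
      rw [hslice]
      exact h j

theorem lintegral_dual {g : ℝ × ℤ → ℝ≥0∞} (hg : Measurable g) :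
    ∫⁻ p, g p ∂dualMeasure = ∑' j : ℤ, ∫⁻ x : ℝ, g (x, j) := by
  rw [dualMeasure, lintegral_prod_symm' _ hg, lintegral_count]

theorem ae_ae_RT {P : ℝ × Torus → Prop} (h : ∀ᵐ p : ℝ × Torus, P p) :
    ∀ᵐ x : ℝ, ∀ᵐ θ : Torus, P (x, θ) :=
  Measure.ae_ae_of_ae_prod h

theorem lintegral_RT {g : ℝ × Torus → ℝ≥0∞} (hg : Measurable g) :
    ∫⁻ p, g p = ∫⁻ x : ℝ, ∫⁻ θ : Torus, g (x, θ) :=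
  lintegral_prod _ hg.aemeasurable

theorem parseval_aux {T : ℝ} [hT : Fact (0 < T)] {u : AddCircle T → ℂ} (hu : MemLp u 2) :
    HasSum (fun j : ℤ => ‖∫ θ, fourier (-j) θ * u θ‖ ^ 2) (T * ∫ θ, ‖u θ‖ ^ 2) := by
  have hu' : MemLp u 2 AddCircle.haarAddCircle := memLp_haarAddCircle_iff.2 hu
  have h := hasSum_sq_fourierCoeff (hu'.toLp u)
  have hpos : T ≠ 0 := hT.out.ne'
  have hc : ∀ j : ℤ, T ^ 2 * ‖fourierCoeff (hu'.toLp u) j‖ ^ 2 =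
      ‖∫ θ, fourier (-j) θ * u θ‖ ^ 2 := fun j => by
    rw [fourierCoeff_congr_ae hu'.coeFn_toLp, fourierCoeff, AddCircle.integral_haarAddCircle,
      norm_smul, norm_inv, norm_eq_abs, abs_of_pos hT.out, mul_pow, inv_pow,
      mul_inv_cancel_left₀ (pow_ne_zero 2 hpos)]
    simp only [smul_eq_mul]
  have hi : T ^ 2 * ∫ t, ‖hu'.toLp u t‖ ^ 2 ∂AddCircle.haarAddCircle = T * ∫ θ, ‖u θ‖ ^ 2 := by
    have hae : (fun t => ‖hu'.toLp u t‖ ^ 2) =ᵐ[AddCircle.haarAddCircle] fun t => ‖u t‖ ^ 2 :=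
      hu'.coeFn_toLp.fun_comp (fun z => ‖z‖ ^ 2)
    have h1 : ∫ t, ‖u t‖ ^ 2 ∂AddCircle.haarAddCircle = T⁻¹ * ∫ θ, ‖u θ‖ ^ 2 :=
      AddCircle.integral_haarAddCircle
    rw [integral_congr_ae hae, h1, ← mul_assoc, pow_two, mul_inv_cancel_right₀ hpos]
  have h3 := h.mul_left (T ^ 2)
  rw [hi, funext hc] at h3
  exact h3

theorem parseval_torus {u : Torus → ℂ} (hu : MemLp u 2) :
    ∑' j : ℤ, ‖∫ θ, fourier (-j) θ * u θ‖ₑ ^ 2 = ENNReal.ofReal (2 * π) * ∫⁻ θ, ‖u θ‖ₑ ^ 2 := by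
  have h2 : Integrable (fun θ => ‖u θ‖ ^ 2) (volume : Measure Torus) :=
    (memLp_two_iff_integrable_sq_norm hu.1).1 hu
  have h4 := parseval_aux hu
  have h5 := ENNReal.ofReal_tsum_of_nonneg (fun j => sq_nonneg _) h4.summable
  rw [h4.tsum_eq, ENNReal.ofReal_mul Real.two_pi_pos.le,
    ofReal_integral_eq_lintegral_ofReal h2 (.of_forall fun θ => sq_nonneg _)] at h5
  simp_rw [ENNReal.ofReal_pow (norm_nonneg _), ofReal_norm] at h5
  exact h5.symm

/-- The Fourier transform in the periodic variable: `(𝓕₂ f)(x, j) = ∫ f(x, θ) e^{-ijθ} dθ`. -/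
def torusCoeff (f : ℝ × Torus → ℂ) (j : ℤ) (x : ℝ) : ℂ := ∫ θ : Torus, fourier (-j) θ * f (x, θ)

theorem measurable_torusCoeff {f : ℝ × Torus → ℂ} (hf : StronglyMeasurable f) (j : ℤ) :
    Measurable (torusCoeff f j) := by
  have : StronglyMeasurable (fun p : ℝ × Torus => fourier (-j) p.2 * f p) :=
    ((fourier (-j)).continuous.stronglyMeasurable.comp_measurable measurable_snd).mul hf
  exact this.integral_prod_right.measurable

theorem ae_memLp_slice (f : L2RT) : ∀ᵐ x : ℝ, MemLp (fun θ : Torus => f (x, θ)) 2 := by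
  have h : Integrable (fun p => ‖f p‖ ^ 2) (volume : Measure (ℝ × Torus)) :=
    (memLp_two_iff_integrable_sq_norm (Lp.memLp f).1).1 (Lp.memLp f)
  filter_upwards [Integrable.prod_right_ae (μ := (volume : Measure ℝ)) (ν := (volume : Measure Torus)) h] with x hx
  refine (memLp_two_iff_integrable_sq_norm ?_).2 hx
  exact ((Lp.stronglyMeasurable f).comp_measurable measurable_prodMk_left).aestronglyMeasurable

theorem tsum_lintegral_torusCoeff (f : L2RT) :
    ∑' j : ℤ, ∫⁻ x, ‖torusCoeff f j x‖ₑ ^ 2 = ENNReal.ofReal (2 * π) * ∫⁻ p, ‖f p‖ₑ ^ 2 := by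
  have hm := fun j => measurable_torusCoeff (Lp.stronglyMeasurable f) j
  have hf := (Lp.stronglyMeasurable f).measurable
  rw [← lintegral_tsum (fun j => by have := hm j; fun_prop),
    lintegral_RT (by fun_prop), ← lintegral_const_mul _ (by fun_prop)]
  refine lintegral_congr_ae ?_
  filter_upwards [ae_memLp_slice f] with x hx
  exact parseval_torus hx

theorem lintegral_sq_eq {α : Type*} [MeasurableSpace α] {μ : Measure α} (u : α → ℂ) :
    ∫⁻ x, ‖u x‖ₑ ^ 2 ∂μ = eLpNorm u 2 μ ^ 2 := by
  rw [eLpNorm_eq_lintegral_rpow_enorm_toReal (by norm_num) (by norm_num), ← ENNReal.rpow_natCast,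
    ← ENNReal.rpow_mul]
  simp

theorem memLp_torusCoeff (f : L2RT) (j : ℤ) : MemLp (torusCoeff f j) 2 := by
  refine ⟨(measurable_torusCoeff (Lp.stronglyMeasurable f) j).aestronglyMeasurable, ?_⟩
  have h := (ENNReal.le_tsum j).trans_eq (tsum_lintegral_torusCoeff f)
  simp only [lintegral_sq_eq] at h
  have : eLpNorm (torusCoeff f j) 2 volume ^ 2 < ∞ :=
    h.trans_lt (ENNReal.mul_lt_top ENNReal.ofReal_lt_top (ENNReal.pow_lt_top (Lp.eLpNorm_lt_top f)))
  simpa using this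

/-- `x ↦ (𝓕₂ f)(x, j)` as an element of `L²(ℝ)`. -/
def torusCoeffL2 (f : L2RT) (j : ℤ) : Lp ℂ 2 (volume : Measure ℝ) := (memLp_torusCoeff f j).toLp

theorem torusCoeffL2_add (f g : L2RT) (j : ℤ) :
    torusCoeffL2 (f + g) j = torusCoeffL2 f j + torusCoeffL2 g j := by
  rw [torusCoeffL2, torusCoeffL2, torusCoeffL2, ← MemLp.toLp_add, MemLp.toLp_eq_toLp_iff]
  filter_upwards [ae_ae_RT (Lp.coeFn_add f g),
    ae_memLp_slice f, ae_memLp_slice g] with x h hf hg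
  have hb : ∀ {u : Torus → ℂ}, MemLp u 2 → Integrable (fun θ => fourier (-j) θ * u θ) := fun hu =>
    (hu.integrable (by norm_num)).bdd_mul (c := 1)
      (fourier (-j)).continuous.aestronglyMeasurable (.of_forall fun θ => by rw [fourier_apply, Circle.norm_coe])
  simp only [torusCoeff, Pi.add_apply]
  rw [← integral_add (hb hf) (hb hg)]
  refine integral_congr_ae ?_
  filter_upwards [h] with θ hθ
  rw [hθ, Pi.add_apply, mul_add]

theorem torusCoeffL2_smul (c : ℂ) (f : L2RT) (j : ℤ) :
    torusCoeffL2 (c • f) j = c • torusCoeffL2 f j := by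
  rw [torusCoeffL2, torusCoeffL2, ← MemLp.toLp_const_smul, MemLp.toLp_eq_toLp_iff]
  filter_upwards [ae_ae_RT (Lp.coeFn_smul c f)]
    with x h
  simp only [torusCoeff, Pi.smul_apply, smul_eq_mul]
  rw [← integral_const_mul]
  refine integral_congr_ae ?_
  filter_upwards [h] with θ hθ
  rw [hθ, Pi.smul_apply, smul_eq_mul]
  ring

/-- The Fourier transform `(𝓕 f)(ξ, j) = ∫∫ f(x, θ) e^{-i(xξ + jθ)} dx dθ`. The inner Fourier transform
is the one of `L²(ℝ)` in Mathlib, whose kernel is `e^{-2πixη}`; it is evaluated at `η = ξ / 2π`. -/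
def fourierFun (f : L2RT) (p : ℝ × ℤ) : ℂ := (𝓕 (torusCoeffL2 f p.2)) (p.1 / (2 * π))

theorem measurable_fourierFun (f : L2RT) : Measurable (fourierFun f) := by
  refine measurable_from_prod_countable_left fun j => ?_
  have := (Lp.stronglyMeasurable (𝓕 (torusCoeffL2 f j))).measurable
  change Measurable fun x => (𝓕 (torusCoeffL2 f j)) (x / (2 * π))
  fun_prop

theorem lintegral_div_two_pi {g : ℝ → ℝ≥0∞} (hg : Measurable g) :
    ∫⁻ x, g (x / (2 * π)) = ENNReal.ofReal (2 * π) * ∫⁻ x, g x := by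
  have h := Real.map_volume_mul_left (a := (2 * π)⁻¹) (by positivity)
  have h2 : ∫⁻ x, g x ∂(Measure.map (fun x => (2 * π)⁻¹ * x) volume) = ∫⁻ x, g (x / (2 * π)) := by
    rw [lintegral_map hg (by fun_prop)]
    simp_rw [div_eq_inv_mul]
  rw [← h2, h, lintegral_smul_measure, inv_inv, abs_of_pos Real.two_pi_pos, smul_eq_mul]

theorem eLpNorm_fourierFun (f : L2RT) :
    eLpNorm (fourierFun f) 2 dualMeasure = ENNReal.ofReal (2 * π) * eLpNorm f 2 volume := by
  have key : eLpNorm (fourierFun f) 2 dualMeasure ^ 2 =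
      (ENNReal.ofReal (2 * π) * eLpNorm f 2 volume) ^ 2 := by
    have hm := measurable_fourierFun f
    rw [← lintegral_sq_eq, lintegral_dual (by fun_prop), mul_pow, ← lintegral_sq_eq f, sq, mul_assoc,
      ← tsum_lintegral_torusCoeff, ← ENNReal.tsum_mul_left]
    congr 1; ext j
    have hg := (Lp.stronglyMeasurable (𝓕 (torusCoeffL2 f j))).measurable
    refine (lintegral_div_two_pi (g := fun ξ => ‖(𝓕 (torusCoeffL2 f j)) ξ‖ₑ ^ 2)
      (by fun_prop)).trans ?_
    rw [lintegral_sq_eq, lintegral_sq_eq, ← Lp.enorm_def, ← ofReal_norm, Lp.norm_fourier_eq,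
      ofReal_norm, Lp.enorm_def, torusCoeffL2, eLpNorm_congr_ae (memLp_torusCoeff f j).coeFn_toLp]
  simpa using (ENNReal.pow_right_strictMono two_ne_zero).injective key

theorem memLp_fourierFun (f : L2RT) : MemLp (fourierFun f) 2 dualMeasure :=
  ⟨(measurable_fourierFun f).aestronglyMeasurable, by
    rw [eLpNorm_fourierFun]; exact ENNReal.mul_lt_top ENNReal.ofReal_lt_top (Lp.eLpNorm_lt_top f)⟩

theorem ae_div_two_pi {P : ℝ → Prop} (h : ∀ᵐ x : ℝ, P x) : ∀ᵐ x : ℝ, P (x / (2 * π)) := by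
  have : Measure.QuasiMeasurePreserving (fun x : ℝ => x / (2 * π)) := by
    refine ⟨by fun_prop, ?_⟩
    have h := Real.map_volume_mul_left (a := (2 * π)⁻¹) (by positivity)
    simp_rw [div_eq_inv_mul]
    rw [h]
    exact Measure.smul_absolutelyContinuous
  exact this.ae h

/-- The Fourier transform as a linear map from `L²(ℝ × 𝕋)` to `L²(ℝ × ℤ)`. -/
def fourierLM : L2RT →ₗ[ℂ] L2RZ where
  toFun f := (memLp_fourierFun f).toLp
  map_add' f g := by
    rw [← MemLp.toLp_add, MemLp.toLp_eq_toLp_iff]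
    refine ae_dual_iff.2 fun j => ?_
    simp only [fourierFun, Pi.add_apply, torusCoeffL2_add, FourierTransform.fourier_add]
    exact ae_div_two_pi (Lp.coeFn_add _ _)
  map_smul' c f := by
    rw [RingHom.id_apply, ← MemLp.toLp_const_smul, MemLp.toLp_eq_toLp_iff]
    refine ae_dual_iff.2 fun j => ?_
    simp only [fourierFun, Pi.smul_apply, torusCoeffL2_smul, FourierTransform.fourier_smul]
    exact ae_div_two_pi (Lp.coeFn_smul _ _)

theorem norm_fourierLM (f : L2RT) : ‖fourierLM f‖ = 2 * π * ‖f‖ := by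
  refine (Lp.norm_toLp _ (memLp_fourierFun f)).trans ?_
  rw [eLpNorm_fourierFun, ENNReal.toReal_mul, ENNReal.toReal_ofReal Real.two_pi_pos.le, Lp.norm_def]

/-- The Fourier transform as a bounded operator. -/
def fourierCLM : L2RT →L[ℂ] L2RZ := fourierLM.mkContinuous (2 * π) fun f => (norm_fourierLM f).le

theorem memLp_tensor (u : Lp ℂ 2 (volume : Measure ℝ)) (j : ℤ) :
    MemLp (fun p : ℝ × Torus => u p.1 * fourier j p.2) 2 := by
  have hu := (Lp.stronglyMeasurable u).measurable
  have hj := (fourier (T := 2 * π) j).continuous.measurable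
  refine ⟨Measurable.aestronglyMeasurable (by fun_prop), ?_⟩
  have : eLpNorm (fun p : ℝ × Torus => u p.1 * fourier j p.2) 2 volume ^ 2 < ∞ := by
    rw [← lintegral_sq_eq, lintegral_RT (by fun_prop)]
    have h1 : ∀ θ : Torus, ‖fourier j θ‖ₑ = 1 := fun θ => by
      rw [← ofReal_norm, fourier_apply, Circle.norm_coe, ENNReal.ofReal_one]
    simp only [enorm_mul, h1, mul_one, lintegral_const]
    rw [lintegral_mul_const _ (by fun_prop), lintegral_sq_eq]
    exact ENNReal.mul_lt_top (ENNReal.pow_lt_top (Lp.eLpNorm_lt_top u)) (measure_lt_top _ _)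
  simpa using this

theorem torusCoeffL2_tensor (u : Lp ℂ 2 (volume : Measure ℝ)) (j k : ℤ) :
    torusCoeffL2 (memLp_tensor u j).toLp k = if k = j then ((2 * π : ℝ) : ℂ) • u else 0 := by
  have hae : torusCoeff (memLp_tensor u j).toLp k =ᵐ[volume]
      fun x => if k = j then ((2 * π : ℝ) : ℂ) * u x else 0 := by
    filter_upwards [ae_ae_RT (memLp_tensor u j).coeFn_toLp] with x hx
    have h1 : torusCoeff (memLp_tensor u j).toLp k x = ∫ θ : Torus, u x * fourier (j - k) θ := by
      refine integral_congr_ae ?_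
      filter_upwards [hx] with θ hθ
      rw [hθ, sub_eq_add_neg, fourier_add]
      ring
    rw [h1, integral_const_mul]
    have h2 : ∫ θ : Torus, fourier (j - k) θ = if k = j then ((2 * π : ℝ) : ℂ) else 0 := by
      split_ifs with h
      · simp [h, Measure.real, AddCircle.measure_univ, Real.pi_pos.le]
      · have h3 := (orthonormal_fourier (T := 2 * π)).2 h
        change inner ℂ (fourierLp 2 k) (fourierLp 2 j) = 0 at h3
        rw [fourierLp, fourierLp, ContinuousMap.inner_toLp, AddCircle.integral_haarAddCircle] at h3
        have h4 : (∫ θ : Torus, fourier j θ * (starRingEnd ℂ) (fourier k θ)) = 0 := by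
          have := smul_eq_zero.1 h3
          refine this.resolve_left ?_
          have := Real.pi_pos; positivity
        rw [← h4]
        congr 1; ext θ
        rw [sub_eq_add_neg, fourier_add, fourier_neg]
    rw [h2]
    split_ifs <;> ring
  apply Lp.ext
  refine ((memLp_torusCoeff _ k).coeFn_toLp.trans hae).trans ?_
  split_ifs with h
  · filter_upwards [Lp.coeFn_smul ((2 * π : ℝ) : ℂ) u] with x hx
    rw [hx, Pi.smul_apply, smul_eq_mul]
  · exact (Lp.coeFn_zero ℂ 2 volume).symm

theorem range_fourierCLM : LinearMap.range (fourierCLM : L2RT →ₗ[ℂ] L2RZ) = ⊤ := by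
  have hpi := Real.two_pi_pos
  have hcl : IsClosed (LinearMap.range (fourierCLM : L2RT →ₗ[ℂ] L2RZ) : Set L2RZ) := by
    have ha : AntilipschitzWith (Real.toNNReal (2 * π)⁻¹) fourierCLM := by
      refine AddMonoidHomClass.antilipschitz_of_bound fourierCLM fun f => ?_
      rw [Real.coe_toNNReal _ (by positivity)]
      change _ ≤ _ * ‖fourierLM f‖
      rw [norm_fourierLM, inv_mul_cancel_left₀ hpi.ne']
    exact ha.isClosed_range fourierCLM.uniformContinuous
  have : CompleteSpace (LinearMap.range (fourierCLM : L2RT →ₗ[ℂ] L2RZ)) := hcl.completeSpace_coe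
  rw [← Submodule.orthogonal_eq_bot_iff, Submodule.eq_bot_iff]
  intro g hg
  have hslice : ∀ j : ℤ, ∀ᵐ p ∂dualMeasure, p.2 = j → g p = 0 := by
    intro j
    have hgm := (Lp.stronglyMeasurable g).measurable
    have hv : MemLp (fun η : ℝ => g (2 * π * η, j)) 2 := by
      refine ⟨Measurable.aestronglyMeasurable (by fun_prop), ?_⟩
      have h1 : ∫⁻ x, ‖g (x, j)‖ₑ ^ 2 < ∞ := by
        have h2 : ∫⁻ p, ‖g p‖ₑ ^ 2 ∂dualMeasure < ∞ := by
          rw [lintegral_sq_eq]; exact ENNReal.pow_lt_top (Lp.eLpNorm_lt_top g)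
        rw [lintegral_dual (by fun_prop)] at h2
        exact (ENNReal.le_tsum j).trans_lt h2
      have h3 := lintegral_div_two_pi (g := fun η : ℝ => ‖g (2 * π * η, j)‖ₑ ^ 2) (by fun_prop)
      have h4 : ∀ x : ℝ, 2 * π * (x / (2 * π)) = x := fun x => by field_simp
      simp only [h4] at h3
      rw [h3, lintegral_sq_eq] at h1
      have h5 : eLpNorm (fun η : ℝ => g (2 * π * η, j)) 2 volume ^ 2 ≠ ∞ := fun h => by
        rw [h, ENNReal.mul_top (by simpa using Real.pi_pos)] at h1
        exact lt_irrefl _ h1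
      have h6 := h5.lt_top
      simpa using h6
    set f : L2RT := (memLp_tensor (𝓕⁻ hv.toLp) j).toLp with hf
    have hF : fourierCLM f =ᵐ[dualMeasure] fun p => if p.2 = j then ((2 * π : ℝ) : ℂ) * g p else 0 := by
      refine (memLp_fourierFun f).coeFn_toLp.trans (ae_dual_iff.2 fun k => ?_)
      simp only [fourierFun, hf, torusCoeffL2_tensor]
      split_ifs with h
      · rw [FourierTransform.fourier_smul, FourierTransform.fourier_fourierInv_eq]
        filter_upwards [ae_div_two_pi ((Lp.coeFn_smul ((2 * π : ℝ) : ℂ) hv.toLp).and hv.coeFn_toLp)]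
          with x hx
        rw [hx.1, Pi.smul_apply, hx.2, smul_eq_mul, h]
        congr 3
        field_simp
      · rw [FourierTransform.fourier_zero]
        exact ae_div_two_pi (Lp.coeFn_zero ℂ 2 volume)
    have h0 := (Submodule.mem_orthogonal _ _).1 hg (fourierCLM f) ⟨f, rfl⟩
    have hint := L2.integrable_inner (𝕜 := ℂ) (fourierCLM f) g
    rw [L2.inner_def] at h0
    have hE : (fun p => inner ℂ (fourierCLM f p) (g p)) =ᵐ[dualMeasure]
        fun p => ((if p.2 = j then 2 * π * ‖g p‖ ^ 2 else 0 : ℝ) : ℂ) := by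
      filter_upwards [hF] with p hp
      rw [hp]
      split_ifs
      · rw [RCLike.inner_apply, map_mul, Complex.conj_ofReal, mul_left_comm, Complex.mul_conj,
          Complex.normSq_eq_norm_sq]
        push_cast; ring
      · simp
    rw [integral_congr_ae hE, integral_complex_ofReal, Complex.ofReal_eq_zero,
      integral_eq_zero_iff_of_nonneg] at h0
    · filter_upwards [h0] with p hp hpj
      simp [hpj, Real.pi_pos.ne'] at hp
      exact hp
    · intro p
      change (0 : ℝ) ≤ if _ then _ else _
      split_ifs <;> positivity
    · have := (hint.congr hE).re
      simpa using this
  apply Lp.ext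
  filter_upwards [ae_all_iff.2 hslice, Lp.coeFn_zero ℂ 2 dualMeasure] with p hp hz
  rw [hp p.2 rfl, hz, Pi.zero_apply]

theorem ker_fourierCLM : LinearMap.ker (fourierCLM : L2RT →ₗ[ℂ] L2RZ) = ⊥ := by
  rw [LinearMap.ker_eq_bot']
  intro f hf
  have h := norm_fourierLM f
  change fourierLM f = 0 at hf
  rw [hf, norm_zero, eq_comm, mul_eq_zero] at h
  exact norm_eq_zero.1 (h.resolve_left Real.two_pi_pos.ne')

/-- The Fourier transform `𝓕`, an isomorphism of `L²(ℝ × 𝕋)` onto `L²(ℝ × ℤ)`. -/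
def fourierRT : L2RT ≃L[ℂ] L2RZ :=
  ContinuousLinearEquiv.ofBijective fourierCLM ker_fourierCLM range_fourierCLM

theorem fourierRT_coeFn (f : L2RT) : fourierRT f =ᵐ[dualMeasure] fourierFun f :=
  (memLp_fourierFun f).coeFn_toLp

theorem norm_fourierRT (f : L2RT) : ‖fourierRT f‖ = 2 * π * ‖f‖ := norm_fourierLM f

/-! ### Fourier multipliers and the operator `P_a` -/

/-- The Fourier multiplier operator `T_m f = 𝓕⁻¹ (m 𝓕 f)` on `L²(ℝ × 𝕋)`, for a bounded measurable
function `m` on `ℝ × ℤ`. -/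
def multiplierOp (m : ℝ × ℤ → ℂ) (hm : MemLp m ∞ dualMeasure) : L2RT →L[ℂ] L2RT :=
  (fourierRT.symm : L2RZ →L[ℂ] L2RT) ∘L
    ((ContinuousLinearMap.mul ℂ ℂ).holderL dualMeasure ∞ 2 2 hm.toLp) ∘L
    (fourierRT : L2RT →L[ℂ] L2RZ)

/-- `m_a(ξ) = e^{aξ} / (2 cosh (aξ))`. -/
def symbol (a ξ : ℝ) : ℝ := exp (a * ξ) / (2 * cosh (a * ξ))

theorem memLp_symbol (a : ℝ) :
    MemLp (fun p : ℝ × ℤ => (symbol a p.1 : ℂ)) ∞ dualMeasure := by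
  refine memLp_top_of_bound (C := 1) ?_ (.of_forall fun p => ?_)
  · have h : Measurable (symbol a) := by
      unfold symbol
      exact (by fun_prop : Measurable fun ξ : ℝ => exp (a * ξ)).div
        ((Real.continuous_cosh.measurable.comp (measurable_const_mul a)).const_mul 2)
    exact (Complex.measurable_ofReal.comp (h.comp measurable_fst)).aestronglyMeasurable
  · have hc := Real.cosh_pos (a * p.1)
    rw [Complex.norm_real, Real.norm_eq_abs, symbol, abs_of_nonneg (by positivity),
      div_le_one (by positivity), Real.cosh_eq]
    have := Real.exp_pos (-(a * p.1))
    linarith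

/-- `P_a = χ₊ (𝒞₂⁻¹ T_{m_a} 𝒞₂) χ₊` as a bounded operator on `L²(ℝ × 𝕋)`. -/
def opP (a : ℝ) : L2RT →L[ℂ] L2RT :=
  extendPos.toContinuousLinearMap ∘L (C2.symm : L2RT →L[ℂ] L2Half) ∘L
    multiplierOp (fun p => (symbol a p.1 : ℂ)) (memLp_symbol a) ∘L
    (C2 : L2Half →L[ℂ] L2RT) ∘L restrictPos

/-! ### The Sobolev spaces `W^{s,2}(ℝ × 𝕋)` -/

/-- `(1 + ξ² + j²)^{s/2}`. -/
def weight (s : ℝ) (p : ℝ × ℤ) : ℝ := (1 + p.1 ^ 2 + (p.2 : ℝ) ^ 2) ^ (s / 2)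

theorem weight_pos (s : ℝ) (p : ℝ × ℤ) : 0 < weight s p := by
  unfold weight; positivity

/-- For `s ≥ 0`, the functions `f ∈ L²(ℝ × 𝕋)` with `(1 + ξ² + j²)^{s/2} 𝓕 f ∈ L²(ℝ × ℤ)`. -/
def sobolevSubmodule (s : ℝ) : Submodule ℂ L2RT where
  carrier := {f | MemLp (fun p => (weight s p : ℂ) * fourierRT f p) 2 dualMeasure}
  zero_mem' := by
    have h : (fun p => (weight s p : ℂ) * fourierRT (0 : L2RT) p) =ᵐ[dualMeasure] 0 := by
      rw [map_zero]
      filter_upwards [Lp.coeFn_zero ℂ 2 dualMeasure] with p hp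
      rw [hp, Pi.zero_apply, mul_zero]
    exact (memLp_congr_ae h).2 MemLp.zero
  add_mem' {f g} hf hg := by
    refine (memLp_congr_ae ?_).2 (MemLp.add hf hg)
    rw [map_add]
    filter_upwards [Lp.coeFn_add (fourierRT f) (fourierRT g)] with p hp
    simp only [hp, Pi.add_apply, mul_add]
  smul_mem' c f hf := by
    refine (memLp_congr_ae ?_).2 (MemLp.const_smul hf c)
    rw [map_smul]
    filter_upwards [Lp.coeFn_smul c (fourierRT f)] with p hp
    simp only [hp, Pi.smul_apply, smul_eq_mul]
    ring

/-- The Sobolev space `W^{s,2}(ℝ × 𝕋)` for `s ≥ 0`. It is a type of its own because its norm, defined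
below, is not the one induced from `L²(ℝ × 𝕋)`. -/
def Sobolev (s : ℝ) : Type := sobolevSubmodule s

instance (s : ℝ) : AddCommGroup (Sobolev s) := inferInstanceAs (AddCommGroup (sobolevSubmodule s))

instance (s : ℝ) : Module ℂ (Sobolev s) := inferInstanceAs (Module ℂ (sobolevSubmodule s))

/-- The inclusion `W^{s,2}(ℝ × 𝕋) ⊆ L²(ℝ × 𝕋)`. -/
def Sobolev.toL2 (s : ℝ) : Sobolev s →ₗ[ℂ] L2RT := (sobolevSubmodule s).subtype

theorem Sobolev.memLp {s : ℝ} (f : Sobolev s) :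
    MemLp (fun p => (weight s p : ℂ) * fourierRT (Sobolev.toL2 s f) p) 2 dualMeasure := f.2

/-- The Bessel potential `f ↦ 𝓕⁻¹ [(1 + ξ² + j²)^{s/2} 𝓕 f]` from `W^{s,2}(ℝ × 𝕋)` to
`L²(ℝ × 𝕋)`. -/
def Sobolev.bessel (s : ℝ) : Sobolev s →ₗ[ℂ] L2RT where
  toFun f := fourierRT.symm (Sobolev.memLp f).toLp
  map_add' f g := by
    rw [← map_add, ← MemLp.toLp_add]
    congr 1
    rw [MemLp.toLp_eq_toLp_iff, map_add, map_add]
    filter_upwards [Lp.coeFn_add (fourierRT (toL2 s f)) (fourierRT (toL2 s g))] with p hp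
    simp only [hp, Pi.add_apply, mul_add]
  map_smul' c f := by
    rw [RingHom.id_apply, ← map_smul, ← MemLp.toLp_const_smul]
    congr 1
    rw [MemLp.toLp_eq_toLp_iff, map_smul, map_smul]
    filter_upwards [Lp.coeFn_smul c (fourierRT (toL2 s f))] with p hp
    simp only [hp, Pi.smul_apply, smul_eq_mul]
    ring

theorem Sobolev.bessel_injective (s : ℝ) : Function.Injective (Sobolev.bessel s) := by
  rw [injective_iff_map_eq_zero]
  intro f hf
  have h1 : (Sobolev.memLp f).toLp = 0 := by
    have h := (ContinuousLinearEquiv.map_eq_zero_iff fourierRT.symm).1 hf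
    exact h
  have h2 : fourierRT (Sobolev.toL2 s f) = 0 := by
    apply Lp.ext
    filter_upwards [(Sobolev.memLp f).coeFn_toLp, Lp.coeFn_zero ℂ 2 dualMeasure] with p hp h0
    rw [h1, h0, Pi.zero_apply, eq_comm, mul_eq_zero] at hp
    rw [h0, Pi.zero_apply]
    exact hp.resolve_left (by exact_mod_cast (weight_pos s p).ne')
  have h3 := (ContinuousLinearEquiv.map_eq_zero_iff fourierRT).1 h2
  exact Subtype.ext h3

/-- The norm `‖f‖_{W^{s,2}} = ‖𝓕⁻¹ [(1 + ξ² + j²)^{s/2} 𝓕 f]‖_{L²(ℝ × 𝕋)}`. -/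
instance (s : ℝ) : NormedAddCommGroup (Sobolev s) :=
  NormedAddCommGroup.induced (Sobolev s) L2RT (Sobolev.bessel s) (Sobolev.bessel_injective s)

instance (s : ℝ) : NormedSpace ℂ (Sobolev s) :=
  NormedSpace.induced ℂ (Sobolev s) L2RT (Sobolev.bessel s)

theorem Sobolev.norm_def {s : ℝ} (f : Sobolev s) : ‖f‖ = ‖Sobolev.bessel s f‖ := rfl

end

end MellinFourier

namespace MellinFourier

noncomputable section

open MeasureTheory Real Set Filter Topology
open scoped ENNReal FourierTransform

/-! The operator involves only the variable `x`, so it acts on every angular Fourier coefficient by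
one and the same operator on `L²(ℝ)`. Since `t ↦ t ^ s` is increasing and subadditive for `0 ≤ s ≤
1`, the weight `(1 + j² + ξ²) ^ s` is comparable, uniformly in `j`, to `(1 + j²) ^ s + |ξ| ^ (2s)`.
It therefore suffices to bound the one-dimensional operator in `L²`, where it is a composition of
isometries and contractions, and in the homogeneous norm with weight `|ξ| ^ (2s)`
(`exists_homogeneous_bound`).

The homogeneous norm is a multiple of the Gagliardo seminorm (`gagliardo_univ_eq_fourier`).
Restricted to the half line and written with `x = e^v`, `g(v) = e^{(1/2 - s)v} φ(e^v)`, that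
seminorm becomes an average over `h` of `‖e^{(s - 1/2)h} g(· + h) - g‖²` (`logGagliardo_eq`). This
expression is invariant under translation in `v`, so a Fourier multiplier with bounded symbol is
bounded for it (`logGagliardo_le_of_fourier_le`).

The multiplier `m_a` acts on `F(u) = e^{u/2} φ(e^u)`, whereas the seminorm is expressed through `g =
e^{-su} F`. Conjugation by `e^{-su}` moves the symbol to the line `Im ξ = -s`
(`lineMultiplier_exp_mul`). The poles of `m_a(ξ) = 1 / (1 + e^{-2aξ})` nearest to the real line are
at height `± π / (2|a|)`, so the shifted symbol is bounded exactly in the range of `s` considered.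

Two points remain, and both rest on the fractional Hardy inequality `exists_hardy`, which needs `s <
1/2`: that `g` lies in `L²`, and that the output may be extended by zero to the whole line. The
extension costs a multiple of `∫ x^{-2s} |ψ|²` (`gagliardo_univ_le_of_eq_zero`), which is the `L²`
norm squared of the shifted multiplier applied to `g`. -/

/-! ### The Fourier transform on `L²(ℝ)` -/

/-- `L²(ℝ)`. -/
abbrev L2R : Type := Lp ℂ 2 (volume : Measure ℝ)

/-- Against a test function, both transforms can be moved onto the test function and so give the
same integral; a locally integrable function is determined by such integrals. -/
theorem fourier_toLp_ae_eq {f : ℝ → ℂ} (h1 : Integrable f) (h2 : MemLp f 2) :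
    (𝓕 (h2.toLp f) : L2R) =ᵐ[volume] 𝓕 f := by
  have hL : LocallyIntegrable (𝓕 (h2.toLp f) : L2R) volume :=
    (Lp.memLp (𝓕 (h2.toLp f) : L2R)).locallyIntegrable (by norm_num)
  have hc : Continuous (𝓕 f) := VectorFourier.fourierIntegral_continuous
    Real.continuous_fourierChar (by fun_prop) h1
  refine ae_eq_of_integral_contDiff_smul_eq hL hc.locallyIntegrable fun g hg hgs => ?_
  have hgs' : HasCompactSupport (fun x => (g x : ℂ)) :=
    hgs.comp_left (g := fun x : ℝ => (x : ℂ)) Complex.ofReal_zero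
  have hg' : ContDiff ℝ (⊤ : ℕ∞) (fun x => (g x : ℂ)) := Complex.ofRealCLM.contDiff.comp hg
  set G : SchwartzMap ℝ ℂ := hgs'.toSchwartzMap hg' with hG
  have key := congrArg (fun T => T G) (Lp.fourier_toTemperedDistribution_eq (h2.toLp f))
  simp only [TemperedDistribution.fourier_apply, Lp.toTemperedDistribution_apply] at key
  have h3 : ∫ x, 𝓕 (G : ℝ → ℂ) x • f x = ∫ x, G x • 𝓕 f x := by
    have := VectorFourier.integral_fourierIntegral_smul_eq_flip (L := innerₗ ℝ)
      Real.continuous_fourierChar continuous_inner (G.integrable (μ := volume)) h1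
    rwa [flip_innerₗ] at this
  have h4 : ∫ x, (𝓕 G) x • (h2.toLp f) x = ∫ x, (𝓕 (G : ℝ → ℂ)) x • f x := by
    refine integral_congr_ae ?_
    filter_upwards [h2.coeFn_toLp] with x hx
    rw [hx, SchwartzMap.fourier_coe]
  rw [h4, h3] at key
  simpa [hG] using key.symm

theorem lintegral_fourier_sq (φ : L2R) : ∫⁻ η, ‖(𝓕 φ : L2R) η‖ₑ ^ 2 = ∫⁻ x, ‖φ x‖ₑ ^ 2 := by
  rw [lintegral_sq_eq, lintegral_sq_eq, ← Lp.enorm_def, ← Lp.enorm_def, ← ofReal_norm,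
    Lp.norm_fourier_eq, ofReal_norm]

/-- `φ ↦ φ(· + h)`. -/
def translate (h : ℝ) : L2R →ₗᵢ[ℂ] L2R :=
  weightedComp (fun _ => 1) (fun x => x + h) measurable_const (by fun_prop) fun g _ => by
    simpa using lintegral_add_right_eq_self g h

/-- The character `η ↦ e^{2πihη}`. -/
def expChar (h η : ℝ) : ℂ := Real.fourierChar (h * η)

theorem norm_expChar (h η : ℝ) : ‖expChar h η‖ = 1 := by rw [expChar, Circle.norm_coe]

theorem continuous_expChar : Continuous fun p : ℝ × ℝ => expChar p.1 p.2 := by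
  unfold expChar
  exact continuous_subtype_val.comp (Real.continuous_fourierChar.comp (by fun_prop))

theorem measurable_expChar (h : ℝ) : Measurable (expChar h) :=
  (continuous_expChar.comp (by fun_prop : Continuous fun η : ℝ => (h, η))).measurable

/-- `φ ↦ e^{2πihη} φ`. -/
def modulate (h : ℝ) : L2R →ₗᵢ[ℂ] L2R :=
  weightedComp (expChar h) id (measurable_expChar h) measurable_id fun g _ => by
    simp [← ofReal_norm, norm_expChar]

theorem translate_coeFn (h : ℝ) (φ : L2R) : translate h φ =ᵐ[volume] fun x => φ (x + h) := by
  filter_upwards [weightedComp_coeFn (fun _ => (1 : ℂ)) (fun x : ℝ => x + h) measurable_const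
    (by fun_prop) (fun g _ => by simpa using lintegral_add_right_eq_self g h) φ] with x hx
  exact hx.trans (one_mul _)

theorem modulate_coeFn (h : ℝ) (φ : L2R) :
    modulate h φ =ᵐ[volume] fun x => expChar h x * φ x :=
  weightedComp_coeFn (expChar h) id (measurable_expChar h) measurable_id (fun g _ => by
    simp [← ofReal_norm, norm_expChar]) φ

/-- Both sides are continuous in `φ`, and on the dense set of Schwartz functions the integral
formula applies. -/
theorem fourier_translate (h : ℝ) (φ : L2R) : 𝓕 (translate h φ) = modulate h (𝓕 φ) := by
  refine DenseRange.induction_on (p := fun φ : L2R => 𝓕 (translate h φ) = modulate h (𝓕 φ))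
    (SchwartzMap.denseRange_toLpCLM (E := ℝ) (F := ℂ) (p := 2) (μ := volume)
      ENNReal.ofNat_ne_top) φ ?_ ?_
  · exact isClosed_eq ((Lp.fourierTransformₗᵢ ℝ ℂ).continuous.comp (translate h).continuous)
      ((modulate h).continuous.comp (Lp.fourierTransformₗᵢ ℝ ℂ).continuous)
  · intro f
    rw [SchwartzMap.toLpCLM_apply, SchwartzMap.toLp_fourier_eq]
    have hf2 : MemLp (fun x => f (x + h)) 2 :=
      (f.memLp 2 volume).comp_measurePreserving (measurePreserving_add_right volume h)
    have e : translate h (f.toLp 2) = hf2.toLp := by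
      apply Lp.ext
      filter_upwards [translate_coeFn h (f.toLp 2), hf2.coeFn_toLp,
        (measurePreserving_add_right volume h).quasiMeasurePreserving.ae (f.coeFn_toLp 2 volume)]
        with x h1 h2 h3
      rw [h1, h2, h3]
    rw [e]
    apply Lp.ext
    filter_upwards [fourier_toLp_ae_eq (f.integrable.comp_add_right h) hf2, modulate_coeFn h ((𝓕 f).toLp 2),
      (𝓕 f).coeFn_toLp 2 volume] with η h1 h2 h3
    rw [h1, h2, h3]
    have := congrFun (VectorFourier.fourierIntegral_comp_add_right Real.fourierChar volume
      (innerₗ ℝ) f h) η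
    refine this.trans ?_
    simp only [expChar, SchwartzMap.fourier_coe, Circle.smul_def, innerₗ_apply_apply]
    simp [mul_comm]
    rfl

/-- Plancherel for `c • translate h φ - φ`. The case `c = 1` serves the Gagliardo seminorm on the
line; `c = e^{(s - 1/2)h}` serves `logDiff`. -/
theorem lintegral_translate_sub (φ : L2R) (c : ℂ) (h : ℝ) :
    ∫⁻ x, ‖c * φ (x + h) - φ x‖ₑ ^ 2 =
      ∫⁻ η, ‖c * expChar h η - 1‖ₑ ^ 2 * ‖(𝓕 φ : L2R) η‖ₑ ^ 2 := by
  have h1 : ∫⁻ x, ‖c * φ (x + h) - φ x‖ₑ ^ 2 = ∫⁻ x, ‖(c • translate h φ - φ : L2R) x‖ₑ ^ 2 := by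
    refine lintegral_congr_ae ?_
    filter_upwards [Lp.coeFn_sub (c • translate h φ) φ, Lp.coeFn_smul c (translate h φ),
      translate_coeFn h φ] with x h1 h2 h3
    rw [h1, Pi.sub_apply, h2, Pi.smul_apply, h3, smul_eq_mul]
  rw [h1, ← lintegral_fourier_sq]
  have h2 : (𝓕 (c • translate h φ - φ) : L2R) = c • modulate h (𝓕 φ) - 𝓕 φ := by
    have := (Lp.fourierTransformₗᵢ ℝ ℂ).map_sub (c • translate h φ) φ
    refine this.trans ?_
    change 𝓕 (c • translate h φ) - 𝓕 φ = _
    rw [FourierTransform.fourier_smul, fourier_translate]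
  rw [h2]
  refine lintegral_congr_ae ?_
  filter_upwards [Lp.coeFn_sub (c • modulate h (𝓕 φ)) (𝓕 φ), Lp.coeFn_smul c (modulate h (𝓕 φ)),
      modulate_coeFn h (𝓕 φ)] with x h1 h2 h3
  rw [h1, Pi.sub_apply, h2, Pi.smul_apply, h3, smul_eq_mul, ← mul_pow, ← enorm_mul]
  congr 2
  ring

/-! ### Gagliardo seminorms -/

/-- The kernel `|t|^{-1-2s}`. -/
def gagKernel (s t : ℝ) : ℝ≥0∞ := ENNReal.ofReal (|t| ^ (-(1 + 2 * s)))

theorem measurable_gagKernel (s : ℝ) : Measurable (gagKernel s) := by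
  unfold gagKernel; fun_prop

theorem gagKernel_neg (s t : ℝ) : gagKernel s (-t) = gagKernel s t := by simp [gagKernel]

theorem gagKernel_mul (s c t : ℝ) :
    gagKernel s (c * t) = ENNReal.ofReal (|c| ^ (-(1 + 2 * s))) * gagKernel s t := by
  rw [gagKernel, gagKernel, abs_mul, Real.mul_rpow (abs_nonneg _) (abs_nonneg _),
    ENNReal.ofReal_mul (by positivity)]

/-- The Gagliardo seminorm `∫_A ∫_A |φ(x) - φ(y)|² |x - y|^{-1-2s} dy dx`, squared. -/
def gagliardo (s : ℝ) (A : Set ℝ) (φ : ℝ → ℂ) : ℝ≥0∞ :=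
  ∫⁻ x in A, ∫⁻ y in A, gagKernel s (x - y) * ‖φ x - φ y‖ₑ ^ 2

theorem gagliardo_mono (s : ℝ) {A B : Set ℝ} (h : A ⊆ B) (φ : ℝ → ℂ) :
    gagliardo s A φ ≤ gagliardo s B φ :=
  lintegral_mono' (Measure.restrict_mono h le_rfl)
    fun _ => lintegral_mono' (Measure.restrict_mono h le_rfl) le_rfl

/-- `∫ |h|^{-1-2s} |e^{2πih} - 1|² dh`. -/
def gagConst (s : ℝ) : ℝ≥0∞ := ∫⁻ h, gagKernel s h * ‖expChar h 1 - 1‖ₑ ^ 2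

theorem expChar_mul (h η : ℝ) : expChar h η = expChar (η * h) 1 := by
  simp [expChar, mul_comm]

/-- The substitution `t = ηh` produces `|η| ^ (1 + 2s)` from the kernel and `|η|⁻¹` from the
measure. -/
theorem lintegral_gagKernel_expChar (s : ℝ) {η : ℝ} (hη : η ≠ 0) :
    ∫⁻ h, gagKernel s h * ‖expChar h η - 1‖ₑ ^ 2 =
      ENNReal.ofReal (|η| ^ (2 * s)) * gagConst s := by
  have hm : Measurable fun t => gagKernel s (η⁻¹ * t) * ‖expChar t 1 - 1‖ₑ ^ 2 := by
    have h1 := measurable_gagKernel s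
    have h2 : Measurable fun t => expChar t 1 :=
      (continuous_expChar.comp (by fun_prop : Continuous fun t : ℝ => (t, (1 : ℝ)))).measurable
    fun_prop
  have h := Real.map_volume_mul_left hη
  have h2 : ∫⁻ h, gagKernel s h * ‖expChar h η - 1‖ₑ ^ 2 =
      ∫⁻ t, gagKernel s (η⁻¹ * t) * ‖expChar t 1 - 1‖ₑ ^ 2 ∂(Measure.map (η * ·) volume) := by
    rw [lintegral_map hm (by fun_prop)]
    congr 1; ext t
    rw [inv_mul_cancel_left₀ hη, expChar_mul]
  rw [h2, h, lintegral_smul_measure, smul_eq_mul]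
  simp_rw [gagKernel_mul, mul_assoc]
  rw [lintegral_const_mul' _ _ ENNReal.ofReal_ne_top, ← mul_assoc,
    ← ENNReal.ofReal_mul (abs_nonneg _), gagConst]
  congr 2
  rw [abs_inv, Real.inv_rpow (abs_nonneg _), Real.rpow_neg (abs_nonneg _), inv_inv,
    ← Real.rpow_neg_one, ← Real.rpow_add (abs_pos.2 hη)]
  congr 1; ring

theorem gagliardo_univ_eq (s : ℝ) {φ : ℝ → ℂ} (hφ : Measurable φ) :
    gagliardo s univ φ = ∫⁻ h, gagKernel s h * ∫⁻ x, ‖φ (x + h) - φ x‖ₑ ^ 2 := by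
  have hk := measurable_gagKernel s
  have h1 : ∀ x, ∫⁻ y, gagKernel s (x - y) * ‖φ x - φ y‖ₑ ^ 2 =
      ∫⁻ h, gagKernel s h * ‖φ (x + h) - φ x‖ₑ ^ 2 := fun x => by
    rw [← lintegral_add_left_eq_self _ x]
    congr 1; ext h
    rw [sub_add_cancel_left, gagKernel_neg, ← enorm_neg, neg_sub]
  simp only [gagliardo, Measure.restrict_univ, h1]
  rw [lintegral_lintegral_swap (by fun_prop)]
  congr 1; ext h
  rw [lintegral_const_mul _ (by fun_prop)]

/-- Plancherel in `x` for each fixed shift `h = y - x`, then Tonelli, then the scaling of the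
`h`-integral. -/
theorem gagliardo_univ_eq_fourier (s : ℝ) (φ : L2R) :
    gagliardo s univ φ =
      gagConst s * ∫⁻ η, ENNReal.ofReal (|η| ^ (2 * s)) * ‖(𝓕 φ : L2R) η‖ₑ ^ 2 := by
  have hk := measurable_gagKernel s
  have he := continuous_expChar.measurable
  have hm := (Lp.stronglyMeasurable (𝓕 φ : L2R)).measurable
  rw [gagliardo_univ_eq s (Lp.stronglyMeasurable φ).measurable]
  have h1 : ∀ h, ∫⁻ x, ‖φ (x + h) - φ x‖ₑ ^ 2 =
      ∫⁻ η, ‖expChar h η - 1‖ₑ ^ 2 * ‖(𝓕 φ : L2R) η‖ₑ ^ 2 := fun h => by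
    simpa using lintegral_translate_sub φ 1 h
  simp_rw [h1]
  have h2 : ∀ h, gagKernel s h * ∫⁻ η, ‖expChar h η - 1‖ₑ ^ 2 * ‖(𝓕 φ : L2R) η‖ₑ ^ 2 =
      ∫⁻ η, gagKernel s h * ‖expChar h η - 1‖ₑ ^ 2 * ‖(𝓕 φ : L2R) η‖ₑ ^ 2 := fun h => by
    rw [← lintegral_const_mul' (gagKernel s h) _ ENNReal.ofReal_ne_top]
    simp_rw [mul_assoc]
  simp_rw [h2]
  rw [lintegral_lintegral_swap (by fun_prop), ← lintegral_const_mul _ (by fun_prop)]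
  refine lintegral_congr_ae ?_
  have h0 : ∀ᵐ η : ℝ, η ≠ 0 := by simp [ae_iff]
  filter_upwards [h0] with η hη
  rw [lintegral_mul_const _ (by fun_prop), lintegral_gagKernel_expChar s hη]
  ring

theorem gagConst_ne_zero (s : ℝ) : gagConst s ≠ 0 := by
  have hk := measurable_gagKernel s
  have he : Measurable fun t => expChar t 1 :=
    (continuous_expChar.comp (by fun_prop : Continuous fun t : ℝ => (t, (1 : ℝ)))).measurable
  intro h
  rw [gagConst, lintegral_eq_zero_iff (by fun_prop)] at h
  have h1 : volume (Ioo (0 : ℝ) 1) = 0 := by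
    refine measure_mono_null (fun t ht => ?_) (ae_iff.1 h)
    simp only [mem_ofPred_eq, Pi.zero_apply, mul_eq_zero, not_or]
    constructor
    · rw [gagKernel, ENNReal.ofReal_eq_zero, not_le]
      exact Real.rpow_pos_of_pos (abs_pos.2 ht.1.ne') _
    · simp only [ne_eq, OfNat.ofNat_ne_zero, not_false_eq_true, pow_eq_zero_iff, enorm_eq_zero,
        sub_eq_zero, expChar, mul_one, Real.fourierChar_apply, Complex.exp_eq_one_iff, not_exists]
      -- `e^{2πit} = 1` forces `t` to be an integer, and there is none in `(0, 1)`.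
      intro n hn
      have h2 : ((t : ℂ) - n) * (2 * π * Complex.I) = 0 := by
        rw [sub_mul, sub_eq_zero, ← hn]; push_cast; ring
      have h3 : (t : ℂ) = n := by
        have := (mul_eq_zero.1 h2).resolve_right Complex.two_pi_I_ne_zero
        exact sub_eq_zero.1 this
      have h4 : t = n := by exact_mod_cast h3
      have h5 := ht.1
      have h6 := ht.2
      rw [h4] at h5 h6
      have h7 : 0 < n := by exact_mod_cast h5
      have h8 : n < 1 := by exact_mod_cast h6
      omega
  simp at h1

theorem norm_expChar_sub_one_le (h : ℝ) : ‖expChar h 1 - 1‖ ≤ 2 * π * |h| := by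
  rw [expChar, mul_one, Real.fourierChar_apply]
  have := Real.norm_exp_I_mul_ofReal_sub_one_le (x := 2 * π * h)
  rw [mul_comm Complex.I, Real.norm_eq_abs, abs_mul, abs_of_pos Real.two_pi_pos] at this
  exact this

theorem lintegral_rpow_Ioi {p c : ℝ} (hp : 0 < p) (hc : 0 < c) :
    ∫⁻ t in Ioi c, ENNReal.ofReal (t ^ (-(1 + p))) = ENNReal.ofReal (c ^ (-p) / p) := by
  rw [← ofReal_integral_eq_lintegral_ofReal (integrableOn_Ioi_rpow_of_lt (by linarith) hc)
    ((ae_restrict_mem measurableSet_Ioi).mono fun t ht =>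
      Real.rpow_nonneg (hc.trans ht).le _), integral_Ioi_rpow_of_lt (by linarith) hc]
  congr 1
  rw [show -(1 + p) + 1 = -p by ring, neg_div_neg_eq]

/-- Near `0` the integrand is `O(h^{1 - 2s})`, integrable since `s < 1`; at infinity it is `O(h^{-1
- 2s})`, integrable since `s > 0`. The negative half follows because the integrand is even. -/
theorem gagConst_ne_top {s : ℝ} (hs0 : 0 < s) (hs : s < 1) : gagConst s ≠ ∞ := by
  have hpos : ∫⁻ h in Ioi 0, gagKernel s h * ‖expChar h 1 - 1‖ₑ ^ 2 < ∞ := by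
    rw [← Ioc_union_Ioi_eq_Ioi zero_le_one]
    refine (lintegral_union_le _ _ _).trans_lt (ENNReal.add_lt_top.2 ⟨?_, ?_⟩)
    · have h1 : ∀ h ∈ Ioc (0 : ℝ) 1, gagKernel s h * ‖expChar h 1 - 1‖ₑ ^ 2 ≤
          ENNReal.ofReal ((2 * π) ^ 2 * h ^ (1 - 2 * s)) := fun h hh => by
        rw [gagKernel, ← ofReal_norm, ← ENNReal.ofReal_pow (norm_nonneg _),
          ← ENNReal.ofReal_mul (by positivity)]
        refine ENNReal.ofReal_le_ofReal ?_
        have h2 : ‖expChar h 1 - 1‖ ^ 2 ≤ (2 * π * |h|) ^ 2 :=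
          pow_le_pow_left₀ (norm_nonneg _) (norm_expChar_sub_one_le h) 2
        rw [abs_of_pos hh.1] at h2 ⊢
        refine (mul_le_mul_of_nonneg_left h2 (Real.rpow_nonneg hh.1.le _)).trans_eq ?_
        rw [show 1 - 2 * s = -(1 + 2 * s) + 2 by ring, Real.rpow_add hh.1, Real.rpow_two]
        ring
      refine (setLIntegral_mono' measurableSet_Ioc h1).trans_lt ?_
      have h3 : IntegrableOn (fun h : ℝ => (2 * π) ^ 2 * h ^ (1 - 2 * s)) (Ioc 0 1) := by
        have := intervalIntegral.intervalIntegrable_rpow' (a := 0) (b := 1) (r := 1 - 2 * s)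
          (by linarith)
        rw [intervalIntegrable_iff_integrableOn_Ioc_of_le zero_le_one] at this
        exact this.const_mul _
      exact h3.lintegral_lt_top
    · have h1 : ∀ h ∈ Ioi (1 : ℝ), gagKernel s h * ‖expChar h 1 - 1‖ₑ ^ 2 ≤
          ENNReal.ofReal (h ^ (-(1 + 2 * s))) * 4 := fun h hh => by
        have hh' : 0 < h := zero_lt_one.trans hh
        rw [gagKernel, abs_of_pos hh']
        gcongr
        have h2 : ‖expChar h 1 - 1‖ ≤ 2 := by
          refine (norm_sub_le _ _).trans_eq ?_
          rw [norm_expChar, norm_one]; norm_num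
        rw [← ofReal_norm]
        refine (pow_le_pow_left₀ zero_le (ENNReal.ofReal_le_ofReal h2) 2).trans_eq ?_
        norm_num
      refine (setLIntegral_mono' measurableSet_Ioi h1).trans_lt ?_
      rw [lintegral_mul_const _ (by fun_prop), lintegral_rpow_Ioi (by positivity) zero_lt_one]
      exact ENNReal.mul_lt_top ENNReal.ofReal_lt_top (by simp)
  have hneg : ∫⁻ h in Iio 0, gagKernel s h * ‖expChar h 1 - 1‖ₑ ^ 2 < ∞ := by
    refine lt_of_eq_of_lt ?_ hpos
    have h1 := (Measure.measurePreserving_neg (volume : Measure ℝ)).setLIntegral_comp_preimage_emb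
      (MeasurableEquiv.neg ℝ).measurableEmbedding
      (fun h => gagKernel s h * ‖expChar h 1 - 1‖ₑ ^ 2) (Iio 0)
    rw [← h1]
    have h2 : (Neg.neg ⁻¹' Iio (0 : ℝ)) = Ioi 0 := by ext; simp
    change ∫⁻ h in (Neg.neg ⁻¹' Iio (0 : ℝ)), gagKernel s (-h) * ‖expChar (-h) 1 - 1‖ₑ ^ 2 = _
    rw [h2]
    congr 1; ext h
    rw [gagKernel_neg]
    congr 2
    rw [← ofReal_norm, ← ofReal_norm]
    congr 1
    have h3 : expChar (-h) 1 - 1 = -expChar (-h) 1 * (expChar h 1 - 1) := by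
      have : expChar (-h) 1 * expChar h 1 = 1 := by
        simp only [expChar, mul_one]
        rw [← Circle.coe_mul, ← AddChar.map_add_eq_mul]; simp
      linear_combination this
    rw [h3, norm_mul, norm_neg, norm_expChar, one_mul]
  rw [gagConst, ← setLIntegral_univ, ← Iic_union_Ioi (a := (0 : ℝ))]
  refine ((lintegral_union_le _ _ _).trans_lt (ENNReal.add_lt_top.2 ⟨?_, hpos⟩)).ne
  rwa [setLIntegral_congr Iio_ae_eq_Iic.symm]

/-! ### The Gagliardo seminorm on the half line in logarithmic coordinates -/

/-- The kernel `e^h |e^h - 1|^{-1-2s}`. -/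
def logKernel (s h : ℝ) : ℝ≥0∞ := ENNReal.ofReal (exp h) * gagKernel s (exp h - 1)

theorem measurable_logKernel (s : ℝ) : Measurable (logKernel s) := by
  have := measurable_gagKernel s
  unfold logKernel; fun_prop

/-- `∫ |e^{(s - 1/2) h} g(v + h) - g(v)|² dv`. -/
def logDiff (s : ℝ) (g : ℝ → ℂ) (h : ℝ) : ℝ≥0∞ :=
  ∫⁻ v, ‖((exp ((s - 1 / 2) * h) : ℝ) : ℂ) * g (v + h) - g v‖ₑ ^ 2

/-- The Gagliardo seminorm on the half line, squared, of `φ` with `g(v) = e^{(1/2 - s) v} φ(e^v)`. -/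
def logGagliardo (s : ℝ) (g : ℝ → ℂ) : ℝ≥0∞ := ∫⁻ h, logKernel s h * logDiff s g h

theorem enorm_ofReal_exp_sq (x : ℝ) : ‖((exp x : ℝ) : ℂ)‖ₑ ^ 2 = ENNReal.ofReal (exp (2 * x)) := by
  rw [← enorm_exp_half, mul_div_cancel_left₀ _ (two_ne_zero' ℝ)]

/-- Put `x = e^v`, `y = e^{v + h}`. By homogeneity of the kernel, all factors depending on `v`
collect into `e^{(1 - 2s)v}`, which is absorbed by the weight in `g`; what is left of the kernel
depends on `h` alone. -/
theorem logGagliardo_eq (s : ℝ) {φ : ℝ → ℂ} (hφ : Measurable φ) :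
    logGagliardo s (fun v => ((exp ((1 / 2 - s) * v) : ℝ) : ℂ) * φ (exp v)) =
      gagliardo s (Ioi 0) φ := by
  have hk := measurable_gagKernel s
  have hl := measurable_logKernel s
  rw [gagliardo, lintegral_exp_change]
  simp_rw [lintegral_exp_change]
  have h1 : ∀ v, ∫⁻ u, ENNReal.ofReal (exp u) *
        (gagKernel s (exp v - exp u) * ‖φ (exp v) - φ (exp u)‖ₑ ^ 2) =
      ∫⁻ h, ENNReal.ofReal (exp (v + h)) *
        (gagKernel s (exp v - exp (v + h)) * ‖φ (exp v) - φ (exp (v + h))‖ₑ ^ 2) := fun v =>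
    (lintegral_add_left_eq_self _ v).symm
  simp_rw [h1, ← lintegral_const_mul' _ _ ENNReal.ofReal_ne_top]
  rw [lintegral_lintegral_swap (by fun_prop), logGagliardo]
  congr 1; ext h
  rw [logDiff, ← lintegral_const_mul _ (by fun_prop)]
  congr 1; ext v
  have e1 : ((exp ((s - 1 / 2) * h) : ℝ) : ℂ) *
      (((exp ((1 / 2 - s) * (v + h)) : ℝ) : ℂ) * φ (exp (v + h))) -
      ((exp ((1 / 2 - s) * v) : ℝ) : ℂ) * φ (exp v) =
      ((exp ((1 / 2 - s) * v) : ℝ) : ℂ) * -(φ (exp v) - φ (exp (v + h))) := by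
    rw [← mul_assoc, ← Complex.ofReal_mul, ← Real.exp_add,
      show (s - 1 / 2) * h + (1 / 2 - s) * (v + h) = (1 / 2 - s) * v by ring]
    ring
  have e2 : gagKernel s (exp v - exp (v + h)) =
      ENNReal.ofReal (exp (-(1 + 2 * s) * v)) * gagKernel s (exp h - 1) := by
    rw [show exp v - exp (v + h) = exp v * -(exp h - 1) by rw [exp_add]; ring, gagKernel_mul,
      gagKernel_neg, abs_of_pos (exp_pos _), ← Real.exp_mul, mul_comm v]
  rw [e1, e2, enorm_mul, mul_pow, enorm_neg, enorm_ofReal_exp_sq, logKernel]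
  have e3 : ENNReal.ofReal (exp v) * (ENNReal.ofReal (exp (v + h)) *
      ENNReal.ofReal (exp (-(1 + 2 * s) * v))) =
      ENNReal.ofReal (exp h) * ENNReal.ofReal (exp (2 * ((1 / 2 - s) * v))) := by
    simp only [← ENNReal.ofReal_mul (exp_pos _).le, ← exp_add]
    congr 2; ring
  calc _ = ENNReal.ofReal (exp h) * ENNReal.ofReal (exp (2 * ((1 / 2 - s) * v))) *
        (gagKernel s (exp h - 1) * ‖φ (exp v) - φ (exp (v + h))‖ₑ ^ 2) := by ring
    _ = _ := by rw [← e3]; ring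

theorem lintegral_rpow_mul_sq (s : ℝ) (φ : ℝ → ℂ) :
    ∫⁻ x in Ioi 0, ENNReal.ofReal (x ^ (-(2 * s))) * ‖φ x‖ₑ ^ 2 =
      ∫⁻ v, ‖((exp ((1 / 2 - s) * v) : ℝ) : ℂ) * φ (exp v)‖ₑ ^ 2 := by
  rw [lintegral_exp_change]
  congr 1; ext v
  rw [enorm_mul, mul_pow, enorm_ofReal_exp_sq, ← mul_assoc, ← ENNReal.ofReal_mul (exp_pos _).le,
    ← Real.exp_mul, ← exp_add]
  congr 3; ring

/-- Fractional Hardy inequality in logarithmic coordinates. -/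
theorem exists_hardy {s : ℝ} (hs : s < 1 / 2) : ∃ A : ℝ≥0∞, A ≠ 0 ∧ ∀ g : ℝ → ℂ, Measurable g →
    (∀ M : ℝ, ∫⁻ v in Ioi M, ‖g v‖ₑ ^ 2 ≠ ∞) →
    A * ∫⁻ v, ‖g v‖ₑ ^ 2 ≤ logGagliardo s g := by
  have hl := measurable_logKernel s
  -- For shifts `h ∈ (1, 2)` the factor `e^{(s - 1/2)h}` is at most this `c < 1`, so the weighted
  -- translation is a strict contraction and `‖g‖ ≤ (1 - c)⁻¹ ‖e^{(s - 1/2)h} g(· + h) - g‖`.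
  -- Averaging over these `h` gives the constant.
  set c : ℝ := exp (s - 1 / 2) with hc
  have hc1 : c < 1 := by rw [hc, Real.exp_lt_one_iff]; linarith
  have hlog : ∫⁻ h in Ioo 1 2, logKernel s h ≠ 0 := by
    intro h0
    rw [setLIntegral_eq_zero_iff measurableSet_Ioo hl] at h0
    have h1 : volume (Ioo (1 : ℝ) 2) = 0 := by
      refine measure_mono_null (fun t ht => ?_) (ae_iff.1 h0)
      simp only [mem_ofPred_eq, not_forall]
      refine ⟨ht, ?_⟩
      have h3 : 0 < exp t - 1 := by
        have := Real.add_one_lt_exp (x := t) (by have := ht.1; linarith)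
        have := ht.1; linarith
      rw [logKernel, gagKernel, mul_eq_zero, not_or, ENNReal.ofReal_eq_zero, not_le,
        ENNReal.ofReal_eq_zero, not_le]
      exact ⟨exp_pos _, Real.rpow_pos_of_pos (abs_pos.2 h3.ne') _⟩
    simp at h1
  refine ⟨(∫⁻ h in Ioo 1 2, logKernel s h) * ENNReal.ofReal (1 - c) ^ 2, mul_ne_zero hlog
    (pow_ne_zero _ (by rw [ne_eq, ENNReal.ofReal_eq_zero]; linarith)), fun g hg hfin => ?_⟩
  -- Absorbing `c ‖g‖` into the left side requires `‖g‖` to be finite, which is known only on the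
  -- half lines `(M, ∞)`; translation by `h > 0` does not leave them.
  have step : ∀ M : ℝ, ∀ h ∈ Ioo (1 : ℝ) 2,
      ENNReal.ofReal (1 - c) ^ 2 * ∫⁻ v in Ioi M, ‖g v‖ₑ ^ 2 ≤ logDiff s g h := by
    intro M h hh
    set μ := volume.restrict (Ioi M) with hμ
    set n := eLpNorm g 2 μ with hn
    set b : ℂ := ((exp ((s - 1 / 2) * h) : ℝ) : ℂ) with hb
    have hnfin : n ≠ ∞ := by
      intro h
      refine hfin M ?_
      rw [lintegral_sq_eq, ← hμ, ← hn, h]; simp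
    have hbc : ‖b‖ₑ ≤ ENNReal.ofReal c := by
      rw [← ofReal_norm, Complex.norm_real, Real.norm_eq_abs, abs_of_pos (exp_pos _)]
      refine ENNReal.ofReal_le_ofReal (Real.exp_le_exp.2 ?_)
      nlinarith [hh.1]
    have htr : eLpNorm (fun v => g (v + h)) 2 μ ≤ n := by
      have h2 : eLpNorm (fun v => g (v + h)) 2 μ ^ 2 ≤ n ^ 2 := by
        rw [← lintegral_sq_eq, ← lintegral_sq_eq, hμ]
        have h3 := (measurePreserving_add_right (volume : Measure ℝ) h).setLIntegral_comp_preimage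
          (s := Ioi (M + h)) measurableSet_Ioi (f := fun v => ‖g v‖ₑ ^ 2) (by fun_prop)
        have h4 : (fun x => x + h) ⁻¹' Ioi (M + h) = Ioi M := by ext; simp
        rw [h4] at h3
        rw [h3]
        exact lintegral_mono' (Measure.restrict_mono (Ioi_subset_Ioi (by linarith [hh.1])) le_rfl)
          le_rfl
      exact (ENNReal.pow_le_pow_left_iff two_ne_zero).1 h2
    have h1 : n ≤ ENNReal.ofReal c * n + eLpNorm (fun v => b * g (v + h) - g v) 2 μ := by
      have e : g = (fun v => b * g (v + h)) - fun v => b * g (v + h) - g v := by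
        ext v; simp
      have h2 := eLpNorm_sub_le (μ := μ) (p := 2) (f := fun v => b * g (v + h))
        (g := fun v => b * g (v + h) - g v)
        (Measurable.aestronglyMeasurable (by fun_prop))
        (Measurable.aestronglyMeasurable (by fun_prop)) (by norm_num)
      rw [← e] at h2
      refine h2.trans ?_
      gcongr
      have h3 : eLpNorm (fun v => b * g (v + h)) 2 μ = ‖b‖ₑ * eLpNorm (fun v => g (v + h)) 2 μ :=
        eLpNorm_const_smul b (fun v => g (v + h)) 2 μ
      rw [h3]
      gcongr
    have h5 : ENNReal.ofReal (1 - c) * n ≤ eLpNorm (fun v => b * g (v + h) - g v) 2 μ := by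
      have h6 : ENNReal.ofReal (1 - c) * n + ENNReal.ofReal c * n = n := by
        rw [← add_mul, ← ENNReal.ofReal_add (by linarith) (exp_pos _).le, sub_add_cancel,
          ENNReal.ofReal_one, one_mul]
      rw [add_comm] at h6
      nth_rw 1 [← h6] at h1
      exact (ENNReal.add_le_add_iff_left (ENNReal.mul_ne_top ENNReal.ofReal_ne_top hnfin)).1 h1
    calc ENNReal.ofReal (1 - c) ^ 2 * ∫⁻ v in Ioi M, ‖g v‖ₑ ^ 2
        = (ENNReal.ofReal (1 - c) * n) ^ 2 := by rw [lintegral_sq_eq, mul_pow]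
      _ ≤ eLpNorm (fun v => b * g (v + h) - g v) 2 μ ^ 2 := by gcongr
      _ ≤ logDiff s g h := by
        rw [← lintegral_sq_eq]
        exact setLIntegral_le_lintegral _ _
  have step2 : ∀ M : ℝ, (∫⁻ h in Ioo 1 2, logKernel s h) * ENNReal.ofReal (1 - c) ^ 2 *
      ∫⁻ v in Ioi M, ‖g v‖ₑ ^ 2 ≤ logGagliardo s g := fun M => by
    rw [mul_assoc, ← lintegral_mul_const _ hl]
    refine (setLIntegral_mono' measurableSet_Ioo fun h hh => ?_).trans
      (setLIntegral_le_lintegral (Ioo 1 2) _)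
    gcongr
    exact step M h hh
  -- The constant does not depend on `M`, so monotone convergence gives the whole line.
  have hU : ∫⁻ v, ‖g v‖ₑ ^ 2 = ⨆ n : ℕ, ∫⁻ v in Ioi (-(n : ℝ)), ‖g v‖ₑ ^ 2 := by
    rw [← setLIntegral_iUnion_of_directed _
      (directed_of_isDirected_le fun m n hmn => Ioi_subset_Ioi (by simpa using hmn)),
      ← setLIntegral_univ]
    congr 2
    refine (eq_univ_of_forall fun x => mem_iUnion.2 ?_).symm
    obtain ⟨n, hn⟩ := exists_nat_gt (-x)
    exact ⟨n, by simp only [mem_Ioi]; linarith⟩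
  rw [hU, ENNReal.mul_iSup]
  exact iSup_le fun n => step2 _

/-- On the Fourier side each `logDiff` is a weighted `L²` norm of the transform, so a pointwise
bound of transforms passes through it. -/
theorem logGagliardo_le_of_fourier_le (s : ℝ) {g₁ g₂ : L2R} {M : ℝ≥0∞} (hM : M ≠ ∞)
    (h : ∀ᵐ η, ‖(𝓕 g₂ : L2R) η‖ₑ ≤ M * ‖(𝓕 g₁ : L2R) η‖ₑ) :
    logGagliardo s g₂ ≤ M ^ 2 * logGagliardo s g₁ := by
  rw [logGagliardo, logGagliardo, ← lintegral_const_mul' _ _ (by simp [hM])]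
  refine lintegral_mono fun t => ?_
  rw [mul_left_comm]
  gcongr
  rw [logDiff, logDiff, lintegral_translate_sub, lintegral_translate_sub,
    ← lintegral_const_mul' _ _ (by simp [hM])]
  refine lintegral_mono_ae ?_
  filter_upwards [h] with η hη
  calc _ ≤ ‖((exp ((s - 1 / 2) * t) : ℝ) : ℂ) * expChar t η - 1‖ₑ ^ 2 *
        (M * ‖(𝓕 g₁ : L2R) η‖ₑ) ^ 2 := by gcongr
    _ = _ := by rw [mul_pow]; ring

/-! ### Extension by zero from the half line -/

theorem lintegral_gagKernel_Iic {s x : ℝ} (hs : 0 < s) (hx : 0 < x) :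
    ∫⁻ y in Iic 0, gagKernel s (x - y) = ENNReal.ofReal (x ^ (-(2 * s)) / (2 * s)) := by
  rw [← lintegral_rpow_Ioi (by positivity) hx, ← lintegral_indicator measurableSet_Iic,
    ← lintegral_indicator measurableSet_Ioi, ← lintegral_sub_left_eq_self ((Iic 0).indicator fun y => gagKernel s (x - y)) x]
  have h0 : ∀ᵐ t : ℝ, t ≠ x := by simp [ae_iff]
  refine lintegral_congr_ae ?_
  filter_upwards [h0] with t ht
  by_cases h : x < t
  · rw [indicator_of_mem (by simpa using h.le), indicator_of_mem (by simpa using h), sub_sub_cancel, gagKernel,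
      abs_of_pos (hx.trans h)]
  · rw [indicator_of_notMem (by simpa using lt_of_le_of_ne (not_lt.1 h) ht),
      indicator_of_notMem (by simpa using h)]

/-- Split the plane into quadrants. The one with both variables negative contributes nothing; in
each mixed one the difference is the value at the positive point, and integrating the kernel over
the other variable leaves `x^{-2s} / (2s)`. -/
theorem gagliardo_univ_le_of_eq_zero {s : ℝ} (hs : 0 < s) {ψ : ℝ → ℂ} (hψ : Measurable ψ)
    (h0 : ∀ x ≤ 0, ψ x = 0) :
    gagliardo s univ ψ ≤ gagliardo s (Ioi 0) ψ +
      ENNReal.ofReal (1 / s) * ∫⁻ x in Ioi 0, ENNReal.ofReal (x ^ (-(2 * s))) * ‖ψ x‖ₑ ^ 2 := by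
  have hk := measurable_gagKernel s
  have hsplit : ∀ G : ℝ → ℝ≥0∞, ∫⁻ x in univ, G x = (∫⁻ x in Ioi 0, G x) + ∫⁻ x in Iic 0, G x :=
    fun G => by
      rw [setLIntegral_univ, ← compl_Ioi, lintegral_add_compl G measurableSet_Ioi]
  have hmeas : Measurable fun p : ℝ × ℝ => gagKernel s (p.1 - p.2) * ‖ψ p.1 - ψ p.2‖ₑ ^ 2 := by
    fun_prop
  have hB : ∫⁻ x in Ioi 0, ∫⁻ y in Iic 0, gagKernel s (x - y) * ‖ψ x - ψ y‖ₑ ^ 2 =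
      ENNReal.ofReal (1 / (2 * s)) *
        ∫⁻ x in Ioi 0, ENNReal.ofReal (x ^ (-(2 * s))) * ‖ψ x‖ₑ ^ 2 := by
    rw [← lintegral_const_mul' _ _ ENNReal.ofReal_ne_top]
    refine setLIntegral_congr_fun measurableSet_Ioi fun x hx => ?_
    have h1 : ∫⁻ y in Iic 0, gagKernel s (x - y) * ‖ψ x - ψ y‖ₑ ^ 2 =
        ∫⁻ y in Iic 0, gagKernel s (x - y) * ‖ψ x‖ₑ ^ 2 :=
      setLIntegral_congr_fun measurableSet_Iic fun y hy => by
        simp only [h0 y hy, sub_zero]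
    simp only [h1]
    rw [lintegral_mul_const _ (by fun_prop), lintegral_gagKernel_Iic hs hx, ← mul_assoc,
      ← ENNReal.ofReal_mul (by positivity)]
    congr 2; ring
  have hC : ∫⁻ x in Iic 0, ∫⁻ y in Ioi 0, gagKernel s (x - y) * ‖ψ x - ψ y‖ₑ ^ 2 =
      ∫⁻ x in Ioi 0, ∫⁻ y in Iic 0, gagKernel s (x - y) * ‖ψ x - ψ y‖ₑ ^ 2 := by
    rw [lintegral_lintegral_swap (by fun_prop)]
    congr 1; ext x
    congr 1; ext y
    rw [← neg_sub x y, gagKernel_neg, ← enorm_neg, neg_sub]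
  have hD : ∫⁻ x in Iic 0, ∫⁻ y in Iic 0, gagKernel s (x - y) * ‖ψ x - ψ y‖ₑ ^ 2 = 0 := by
    rw [setLIntegral_congr_fun measurableSet_Iic (g := 0) fun x hx => ?_]
    · simp
    · simp only [Pi.zero_apply]
      rw [setLIntegral_congr_fun measurableSet_Iic (g := 0) fun y hy => ?_]
      · simp
      · simp [h0 x hx, h0 y hy]
  have hi1 : ∀ x, ∫⁻ y in univ, gagKernel s (x - y) * ‖ψ x - ψ y‖ₑ ^ 2 =
      (∫⁻ y in Ioi 0, gagKernel s (x - y) * ‖ψ x - ψ y‖ₑ ^ 2) +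
      ∫⁻ y in Iic 0, gagKernel s (x - y) * ‖ψ x - ψ y‖ₑ ^ 2 := fun x => hsplit fun y => _
  have hmI : ∀ A : Set ℝ, Measurable fun x => ∫⁻ y in A, gagKernel s (x - y) * ‖ψ x - ψ y‖ₑ ^ 2 :=
    fun A => hmeas.lintegral_prod_right'
  rw [gagliardo]
  simp_rw [hi1]
  rw [hsplit, lintegral_add_left (hmI _), lintegral_add_left (hmI _), hC, hD, hB, add_zero,
    add_assoc, ← add_mul, ← ENNReal.ofReal_add (by positivity) (by positivity), gagliardo]
  apply le_of_eq
  congr 3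
  field_simp
  norm_num

/-! ### Shifting the line of integration -/

open Complex in
/-- The integral of a holomorphic function along the horizontal lines of a strip does not depend
on the line, if the integrals of its absolute value are bounded. -/
theorem integral_eq_integral_add_of_bounded {Φ : ℂ → ℂ} {T : ℝ} {B : ℝ≥0∞} (hB : B ≠ ∞)
    (hΦ : DifferentiableOn ℂ Φ {z | z.im ∈ uIcc 0 T}) (hm : Measurable Φ)
    (hb : ∀ y ∈ uIcc 0 T, ∫⁻ x : ℝ, ‖Φ (x + y * I)‖ₑ ≤ B) :
    ∫ x : ℝ, Φ x = ∫ x : ℝ, Φ (x + T * I) := by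
  have hint : ∀ y ∈ uIcc 0 T, Integrable fun x : ℝ => Φ (x + y * I) := fun y hy =>
    ⟨Measurable.aestronglyMeasurable (by fun_prop), (hb y hy).trans_lt hB.lt_top⟩
  have hint0 : Integrable fun x : ℝ => Φ x := by simpa using hint 0 left_mem_uIcc
  have hintT := hint T right_mem_uIcc
  -- By Cauchy on a rectangle, `D R` equals the contribution of the vertical sides, bounded by `S
  -- R`. No pointwise decay of `Φ` is available, but `S` is integrable in `R`, which is enough to
  -- exclude a nonzero limit of `D`.
  set D : ℝ → ℂ := fun R => (∫ x in (-R)..R, Φ x) - ∫ x in (-R)..R, Φ (x + T * I) with hD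
  set S : ℝ → ℝ≥0∞ := fun R =>
    ∫⁻ y in uIcc 0 T, (‖Φ (R + y * I)‖ₑ + ‖Φ (-R + y * I)‖ₑ) with hS
  have hlim : Tendsto D atTop (𝓝 ((∫ x : ℝ, Φ x) - ∫ x : ℝ, Φ (x + T * I))) :=
    (intervalIntegral_tendsto_integral hint0 tendsto_neg_atTop_atBot tendsto_id).sub
      (intervalIntegral_tendsto_integral hintT tendsto_neg_atTop_atBot tendsto_id)
  have hDS : ∀ R, ‖D R‖ₑ ≤ S R := by
    intro R
    have h1 := Complex.integral_boundary_rect_eq_zero_of_differentiableOn Φ (-R : ℂ) (R + T * I)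
      (hΦ.mono fun z hz => by simpa using hz.2)
    simp only [neg_re, ofReal_re, neg_im, ofReal_im, neg_zero, add_re, mul_re, I_re, mul_zero, I_im,
      mul_one, sub_self, add_zero, add_im, mul_im, zero_add, ofReal_zero, zero_mul] at h1
    have h2 : D R = I • (∫ y in (0:ℝ)..T, Φ (-R + y * I)) - I • ∫ y in (0:ℝ)..T, Φ (R + y * I) := by
      rw [hD]
      push_cast at h1
      linear_combination h1
    have h3 : ∀ w : ℝ → ℂ, ‖∫ y in (0:ℝ)..T, w y‖ₑ ≤ ∫⁻ y in uIcc 0 T, ‖w y‖ₑ := fun w => by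
      rw [← ofReal_norm, intervalIntegral.norm_intervalIntegral_eq, ofReal_norm]
      exact (enorm_integral_le_lintegral_enorm _).trans
        (lintegral_mono' (Measure.restrict_mono uIoc_subset_uIcc le_rfl) le_rfl)
    rw [h2, sub_eq_add_neg]
    refine (enorm_add_le _ _).trans ?_
    rw [enorm_neg, smul_eq_mul, smul_eq_mul, enorm_mul, enorm_mul,
      show ‖I‖ₑ = 1 by rw [← ofReal_norm]; simp, one_mul, one_mul, hS, add_comm]
    dsimp only
    rw [lintegral_add_left (by fun_prop)]
    exact add_le_add (h3 _) (h3 _)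
  have hSfin : ∫⁻ R, S R ≠ ∞ := by
    rw [hS, lintegral_lintegral_swap (by fun_prop)]
    have h4 : ∀ y ∈ uIcc 0 T,
        ∫⁻ R : ℝ, (‖Φ (R + y * I)‖ₑ + ‖Φ (-R + y * I)‖ₑ) ≤ 2 * B := fun y hy => by
      rw [lintegral_add_left (by fun_prop), two_mul]
      refine add_le_add (hb y hy) ?_
      have h5 := lintegral_neg_eq_self (fun x : ℝ => ‖Φ (x + y * I)‖ₑ) (μ := volume)
      push_cast at h5
      rw [h5]
      exact hb y hy
    refine ((setLIntegral_mono' measurableSet_uIcc h4).trans_lt ?_).ne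
    rw [lintegral_const]
    refine ENNReal.mul_lt_top (ENNReal.mul_lt_top (by simp) hB.lt_top) ?_
    simp [uIcc]
  by_contra hne
  set d := (∫ x : ℝ, Φ x) - ∫ x : ℝ, Φ (x + T * I) with hd
  have hd0 : ‖d‖ₑ ≠ 0 := by simpa [hd, sub_eq_zero] using hne
  have hev : ∀ᶠ R in atTop, ‖d‖ₑ / 2 < ‖D R‖ₑ :=
    hlim.enorm.eventually_const_lt (ENNReal.half_lt_self hd0 enorm_ne_top)
  obtain ⟨R₀, hR₀⟩ := eventually_atTop.1 hev
  refine hSfin (top_le_iff.1 ?_)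
  calc ∞ = ∫⁻ _ in Ioi R₀, ‖d‖ₑ / 2 := by
        rw [lintegral_const, Measure.restrict_apply_univ, Real.volume_Ioi, ENNReal.mul_top]
        simpa using hd0
    _ ≤ ∫⁻ R in Ioi R₀, S R := setLIntegral_mono' measurableSet_Ioi fun R hR =>
        (hR₀ R (le_of_lt hR)).le.trans (hDS R)
    _ ≤ ∫⁻ R, S R := setLIntegral_le_lintegral _ _

/-! ### The Fourier transform at complex arguments -/

/-- `∫ F(u) e^{-2πiuz} du`. -/
def complexFourier (F : ℝ → ℂ) (z : ℂ) : ℂ :=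
  ∫ u, F u * Complex.exp (-(2 * π * u * z) * Complex.I)

/-- An imaginary shift of the frequency is an exponential weight on the function; this is what turns
conjugation by `e^{2πTu}` into a shift of contour. -/
theorem complexFourier_add_mul_I (F : ℝ → ℂ) (η y : ℝ) :
    complexFourier F (η + y * Complex.I) =
      𝓕 (fun u => ((exp (2 * π * y * u) : ℝ) : ℂ) * F u) η := by
  rw [Real.fourier_real_eq_integral_exp_smul, complexFourier]
  congr 1; ext u
  have h : Complex.exp (-(2 * π * u * (η + y * Complex.I)) * Complex.I) =
      ((exp (2 * π * y * u) : ℝ) : ℂ) * Complex.exp (((-2 * π * u * η : ℝ) : ℂ) * Complex.I) := by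
    rw [Complex.ofReal_exp, ← Complex.exp_add]
    congr 1
    push_cast
    linear_combination (-2 * π * u * y : ℂ) * Complex.I_sq
  rw [h, smul_eq_mul]
  ring

/-- On the bounded support of `F` the kernel and its `z`-derivative are bounded locally uniformly in
`z`, so one may differentiate under the integral. -/
theorem differentiable_complexFourier {F : ℝ → ℂ} (hF : Integrable F) {R : ℝ}
    (hR : ∀ u, R < |u| → F u = 0) : Differentiable ℂ (complexFourier F) := by
  intro z₀
  have hcont : ∀ z : ℂ, Continuous fun u : ℝ => Complex.exp (-(2 * π * u * z) * Complex.I) :=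
    fun z => by fun_prop
  have hR' : ∀ u, F u ≠ 0 → |u| ≤ |R| := fun u hu =>
    (not_lt.1 fun h => hu (hR u h)).trans (le_abs_self R)
  have hexp : ∀ (u : ℝ) (z : ℂ), F u ≠ 0 →
      ‖Complex.exp (-(2 * π * u * z) * Complex.I)‖ ≤ exp (2 * π * |R| * ‖z‖) := fun u z hu => by
    refine (Complex.norm_exp_le_exp_norm _).trans (Real.exp_le_exp.2 ?_)
    have := hR' u hu
    simp only [norm_mul, norm_neg, Complex.norm_I, mul_one, Complex.norm_ofNat, Complex.norm_real,
      Real.norm_eq_abs, abs_of_pos Real.pi_pos]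
    gcongr
  have hb1 : ∀ (u : ℝ) (z : ℂ), ‖F u * Complex.exp (-(2 * π * u * z) * Complex.I)‖ ≤
      ‖F u‖ * exp (2 * π * |R| * ‖z‖) := fun u z => by
    by_cases hu : F u = 0
    · simp [hu]
    · rw [norm_mul]
      gcongr
      exact hexp u z hu
  refine (hasDerivAt_integral_of_dominated_loc_of_deriv_le (Metric.ball_mem_nhds z₀ one_pos)
    (F := fun z u => F u * Complex.exp (-(2 * π * u * z) * Complex.I))
    (F' := fun z u => F u * Complex.exp (-(2 * π * u * z) * Complex.I) * (-(2 * π * u) * Complex.I))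
    (bound := fun u => ‖F u‖ * (exp (2 * π * |R| * (‖z₀‖ + 1)) * (2 * π * |R|)))
    (.of_forall fun z => hF.1.mul (hcont z).aestronglyMeasurable) ?_ ?_ ?_ ?_ ?_).2.differentiableAt
  · exact (hF.norm.mul_const (exp (2 * π * |R| * ‖z₀‖))).mono'
      (hF.1.mul (hcont z₀).aestronglyMeasurable) (.of_forall fun u => hb1 u z₀)
  · exact (hF.1.mul (hcont z₀).aestronglyMeasurable).mul
      (Continuous.aestronglyMeasurable (by fun_prop))
  · refine .of_forall fun u z hz => ?_
    by_cases hu : F u = 0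
    · simp [hu]
    · rw [norm_mul, ← mul_assoc]
      have hz' : ‖z‖ ≤ ‖z₀‖ + 1 := by
        have h1 := norm_sub_norm_le z z₀
        rw [mem_ball_iff_norm] at hz
        linarith
      have h2 := hb1 u z
      have h3 := hR' u hu
      have h4 : ‖-(2 * π * u) * Complex.I‖ ≤ 2 * π * |R| := by
        simp only [norm_mul, norm_neg, Complex.norm_I, mul_one, Complex.norm_ofNat,
          Complex.norm_real, Real.norm_eq_abs, abs_of_pos Real.pi_pos]
        gcongr
      refine mul_le_mul (h2.trans ?_) h4 (norm_nonneg _) (by positivity)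
      gcongr
  · exact hF.norm.mul_const _
  · refine .of_forall fun u z _ => ?_
    have h1 : HasDerivAt (fun z : ℂ => -(2 * π * u * z) * Complex.I)
        (-(2 * π * u) * Complex.I) z := by
      have := (((hasDerivAt_id z).const_mul (2 * π * u : ℂ)).neg).mul_const Complex.I
      simpa using this
    have := (h1.cexp).const_mul (F u)
    rwa [← mul_assoc] at this

theorem memLp_exp_mul {F : ℝ → ℂ} (hF : MemLp F 2) {R : ℝ} (hR : ∀ u, R < |u| → F u = 0) (c : ℝ) :
    MemLp (fun u => ((exp (c * u) : ℝ) : ℂ) * F u) 2 ∧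
      Integrable (fun u => ((exp (c * u) : ℝ) : ℂ) * F u) ∧
      ∫⁻ u, ‖((exp (c * u) : ℝ) : ℂ) * F u‖ₑ ^ 2 ≤
        ENNReal.ofReal (exp (2 * (|c| * R))) * ∫⁻ u, ‖F u‖ₑ ^ 2 := by
  have hm : AEStronglyMeasurable (fun u => ((exp (c * u) : ℝ) : ℂ) * F u) volume :=
    (Continuous.aestronglyMeasurable (by fun_prop)).mul hF.1
  have hle : ∀ u, ‖((exp (c * u) : ℝ) : ℂ) * F u‖ ≤ exp (|c| * R) * ‖F u‖ := fun u => by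
    by_cases hu : F u = 0
    · simp [hu]
    · have h1 : |u| ≤ R := not_lt.1 fun h => hu (hR u h)
      rw [norm_mul, Complex.norm_real, Real.norm_eq_abs, abs_of_pos (exp_pos _)]
      refine mul_le_mul_of_nonneg_right (Real.exp_le_exp.2 ?_) (norm_nonneg _)
      calc c * u ≤ |c * u| := le_abs_self _
        _ = |c| * |u| := abs_mul _ _
        _ ≤ |c| * R := by gcongr
  have h2 : MemLp (fun u => ((exp (c * u) : ℝ) : ℂ) * F u) 2 :=
    MemLp.of_le_mul hF hm (.of_forall hle)
  refine ⟨h2, ?_, ?_⟩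
  · have h3 : IntegrableOn (fun u => ((exp (c * u) : ℝ) : ℂ) * F u) (Icc (-R) R) :=
      (h2.restrict _).integrable (by norm_num)
    rw [← integrableOn_univ]
    refine h3.of_forall_sdiff_eq_zero MeasurableSet.univ fun u hu => ?_
    rw [hR u (not_le.1 fun h => hu.2 (abs_le.1 h)), mul_zero]
  · rw [← lintegral_const_mul' _ _ ENNReal.ofReal_ne_top]
    refine lintegral_mono fun u => ?_
    rw [two_mul, exp_add, ← sq, ENNReal.ofReal_pow (exp_pos _).le, ← mul_pow, ← ofReal_norm,
      ← ofReal_norm, ← ENNReal.ofReal_mul (exp_pos _).le]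
    gcongr
    exact hle u

/-- Plancherel on a horizontal line, where the exponential weight is bounded on the support of `F`.
-/
theorem lintegral_complexFourier_sq_le {F : ℝ → ℂ} (hF : MemLp F 2) {R : ℝ}
    (hR : ∀ u, R < |u| → F u = 0) (y : ℝ) :
    ∫⁻ η : ℝ, ‖complexFourier F (η + y * Complex.I)‖ₑ ^ 2 ≤
      ENNReal.ofReal (exp (2 * (|2 * π * y| * R))) * ∫⁻ u, ‖F u‖ₑ ^ 2 := by
  obtain ⟨h1, h2, h3⟩ := memLp_exp_mul hF hR (2 * π * y)
  refine le_trans (le_of_eq ?_) h3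
  simp_rw [complexFourier_add_mul_I]
  have h4 := lintegral_fourier_sq h1.toLp
  exact (lintegral_congr_ae ((fourier_toLp_ae_eq h2 h1).fun_comp fun z => ‖z‖ₑ ^ 2)).symm.trans
    (h4.trans (lintegral_congr_ae (h1.coeFn_toLp.fun_comp fun z => ‖z‖ₑ ^ 2)))

/-! ### The symbol at complex arguments -/

/-- The holomorphic continuation of `η ↦ m_a(2πη)`. -/
def complexSymbol (a : ℝ) (z : ℂ) : ℂ := (1 + Complex.exp (-(4 * π * a * z)))⁻¹

theorem symbol_two_pi_mul (a η : ℝ) : (symbol a (2 * π * η) : ℂ) = complexSymbol a η := by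
  have h : symbol a (2 * π * η) = (1 + exp (-(4 * π * a * η)))⁻¹ := by
    rw [symbol, Real.cosh_eq, mul_div_cancel₀ _ (two_ne_zero' ℝ), ← one_div,
      div_eq_div_iff (by positivity) (by positivity), mul_add, ← exp_add]
    ring_nf
  rw [h, complexSymbol]
  push_cast
  rfl

/-- Rotating by `e^{-i Im w / 2}` makes the two summands symmetric about the real axis in argument;
the real part is then `(1 + e^{Re w}) cos (Im w / 2)`. -/
theorem cos_le_norm_one_add_exp {w : ℂ} (hw : 0 ≤ cos (w.im / 2)) :
    cos (w.im / 2) ≤ ‖1 + Complex.exp w‖ := by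
  set u : ℂ := Complex.exp (((-(w.im / 2) : ℝ) : ℂ) * Complex.I) with hu
  have h1 : ‖u‖ = 1 := Complex.norm_exp_ofReal_mul_I _
  have h2 : (u * (1 + Complex.exp w)).re = (1 + exp w.re) * cos (w.im / 2) := by
    rw [mul_add, mul_one, hu, ← Complex.exp_add, Complex.add_re, Complex.exp_re, Complex.exp_re]
    simp only [Complex.mul_re, Complex.ofReal_re, Complex.I_re, Complex.ofReal_im, Complex.I_im,
      Complex.mul_im, Complex.add_re, Complex.add_im]
    simp only [mul_zero, sub_self, exp_zero, mul_one, add_zero, zero_add, one_mul,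
      Real.cos_neg]
    rw [show -(w.im / 2) + w.im = w.im / 2 by ring]
    ring
  calc cos (w.im / 2) ≤ (1 + exp w.re) * cos (w.im / 2) := by
        have := mul_nonneg (exp_pos w.re).le hw
        linarith
    _ = (u * (1 + Complex.exp w)).re := h2.symm
    _ ≤ ‖u * (1 + Complex.exp w)‖ := Complex.re_le_norm _
    _ = ‖1 + Complex.exp w‖ := by rw [norm_mul, h1, one_mul]

theorem cos_le_of_mem_uIcc {a T y : ℝ} (hT : |2 * π * a * T| < π / 2) (hy : y ∈ uIcc 0 T) :
    cos (2 * π * a * T) ≤ cos (2 * π * a * y) := by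
  rw [← cos_abs, ← cos_abs (2 * π * a * y)]
  refine cos_le_cos_of_nonneg_of_le_pi (abs_nonneg _) (by linarith [Real.pi_pos]) ?_
  rw [abs_mul, abs_mul (2 * π * a)]
  gcongr 1
  have := abs_sub_left_of_mem_uIcc hy
  simpa using this

theorem cos_pos_of_abs_lt {x : ℝ} (hx : |x| < π / 2) : 0 < cos x :=
  cos_pos_of_mem_Ioo ⟨(abs_lt.1 hx).1, (abs_lt.1 hx).2⟩

/-- The denominator stays uniformly away from zero on the closed strip: the condition on `T` says
that the strip does not reach the first pole. -/
theorem cos_le_norm_denominator {a T : ℝ} (hT : |2 * π * a * T| < π / 2) {z : ℂ}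
    (hz : z.im ∈ uIcc 0 T) :
    cos (2 * π * a * T) ≤ ‖1 + Complex.exp (-(4 * π * a * z))‖ := by
  have him : (-(4 * π * a * z)).im / 2 = -(2 * π * a * z.im) := by
    have : (4 * π * a * z : ℂ) = ((4 * π * a : ℝ) : ℂ) * z := by push_cast; ring
    rw [Complex.neg_im, this, Complex.im_ofReal_mul]
    ring
  have h1 := cos_le_of_mem_uIcc hT hz
  have h2 := cos_pos_of_abs_lt hT
  have h3 := cos_le_norm_one_add_exp (w := -(4 * π * a * z)) (by rw [him, cos_neg]; linarith)
  rw [him, cos_neg] at h3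
  exact h1.trans h3

theorem norm_complexSymbol_le {a T : ℝ} (hT : |2 * π * a * T| < π / 2) {z : ℂ}
    (hz : z.im ∈ uIcc 0 T) : ‖complexSymbol a z‖ ≤ (cos (2 * π * a * T))⁻¹ := by
  rw [complexSymbol, norm_inv]
  exact inv_anti₀ (cos_pos_of_abs_lt hT) (cos_le_norm_denominator hT hz)

theorem differentiableOn_complexSymbol {a T : ℝ} (hT : |2 * π * a * T| < π / 2) :
    DifferentiableOn ℂ (complexSymbol a) {z | z.im ∈ uIcc 0 T} := by
  intro z hz
  refine (DifferentiableAt.inv (by fun_prop) ?_).differentiableWithinAt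
  exact norm_pos_iff.1 ((cos_pos_of_abs_lt hT).trans_le (cos_le_norm_denominator hT hz))

theorem measurable_complexSymbol (a : ℝ) : Measurable (complexSymbol a) := by
  unfold complexSymbol
  fun_prop

theorem memLp_complexSymbol {a T : ℝ} (hT : |2 * π * a * T| < π / 2) {y : ℝ} (hy : y ∈ uIcc 0 T) :
    MemLp (fun η : ℝ => complexSymbol a (η + y * Complex.I)) ∞ := by
  have := measurable_complexSymbol a
  exact memLp_top_of_bound (C := (cos (2 * π * a * T))⁻¹)
    (Measurable.aestronglyMeasurable (by fun_prop))
    (.of_forall fun η => norm_complexSymbol_le hT (by simpa using hy))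

/-! ### Fourier multipliers on `L²(ℝ)` -/

/-- The Fourier multiplier operator on `L²(ℝ)` with symbol `q`. -/
def lineMultiplier (q : ℝ → ℂ) (hq : MemLp q ∞) : L2R →L[ℂ] L2R :=
  ((Lp.fourierTransformₗᵢ ℝ ℂ).symm : L2R →L[ℂ] L2R) ∘L
    ((ContinuousLinearMap.mul ℂ ℂ).holderL volume ∞ 2 2 hq.toLp) ∘L
    (Lp.fourierTransformₗᵢ ℝ ℂ : L2R →L[ℂ] L2R)

theorem fourier_lineMultiplier (q : ℝ → ℂ) (hq : MemLp q ∞) (F : L2R) :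
    (𝓕 (lineMultiplier q hq F) : L2R) =ᵐ[volume] fun η => q η * (𝓕 F : L2R) η := by
  have h : (𝓕 (lineMultiplier q hq F) : L2R) =
      (ContinuousLinearMap.mul ℂ ℂ).holderL volume ∞ 2 2 hq.toLp (𝓕 F : L2R) :=
    (Lp.fourierTransformₗᵢ ℝ ℂ).apply_symm_apply _
  rw [h]
  filter_upwards [(ContinuousLinearMap.mul ℂ ℂ).coeFn_holder (r := 2) hq.toLp (𝓕 F : L2R),
    hq.coeFn_toLp] with η h1 h2
  refine h1.trans ?_
  rw [h2]
  rfl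

/-! ### Conjugation of a multiplier by an exponential weight -/

/-- Restriction of a function to `[-n, n]`. -/
def truncate (n : ℕ) (F : L2R) : L2R :=
  ((Lp.memLp F).indicator (measurableSet_Icc (a := -(n : ℝ)) (b := n))).toLp

theorem tendsto_truncate (F : L2R) : Tendsto (fun n => truncate n F) atTop (𝓝 F) := by
  rw [Lp.tendsto_Lp_iff_tendsto_eLpNorm']
  have hm := (Lp.stronglyMeasurable F).measurable
  have h1 : ∀ n : ℕ, eLpNorm (truncate n F - F : ℝ → ℂ) 2 volume ^ 2 =
      ∫⁻ u, ‖(Icc (-(n : ℝ)) n).indicator F u - F u‖ₑ ^ 2 := fun n => by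
    rw [← lintegral_sq_eq]
    refine lintegral_congr_ae ?_
    filter_upwards [((Lp.memLp F).indicator
      (measurableSet_Icc (a := -(n : ℝ)) (b := n))).coeFn_toLp] with u hu
    rw [Pi.sub_apply, truncate, hu]
  have h2 : Tendsto (fun n : ℕ => ∫⁻ u, ‖(Icc (-(n : ℝ)) n).indicator F u - F u‖ₑ ^ 2) atTop
      (𝓝 (∫⁻ _ : ℝ, 0)) := by
    refine tendsto_lintegral_of_dominated_convergence (fun u => ‖F u‖ₑ ^ 2)
      (fun n => ?_) (fun n => .of_forall fun u => ?_) ?_ (.of_forall fun u => ?_)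
    · have := hm.indicator (measurableSet_Icc (a := -(n : ℝ)) (b := n))
      fun_prop
    · dsimp only
      by_cases hu : u ∈ Icc (-(n : ℝ)) n <;> simp [hu]
    · rw [lintegral_sq_eq]
      exact (ENNReal.pow_lt_top (Lp.eLpNorm_lt_top F)).ne
    · refine tendsto_const_nhds.congr' ?_
      obtain ⟨n₀, hn₀⟩ := exists_nat_ge |u|
      filter_upwards [eventually_ge_atTop n₀] with n hn
      have h3 : u ∈ Icc (-(n : ℝ)) n := abs_le.1 (hn₀.trans (by exact_mod_cast hn))
      simp [h3]
  rw [lintegral_zero] at h2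
  simp_rw [← h1] at h2
  have h3 := h2.ennrpow_const (1 / 2)
  rw [ENNReal.zero_rpow_of_pos (by norm_num)] at h3
  refine h3.congr fun n => ?_
  rw [← ENNReal.rpow_natCast, ← ENNReal.rpow_mul]
  norm_num

-- By Parseval both inner products are integrals of one holomorphic function along the lines of
-- height `0` and `T`. Bounded supports make the transforms entire, and Plancherel on horizontal
-- lines supplies the uniform bound needed to move the contour.
open Complex in
theorem inner_lineMultiplier_eq_of_bounded_support {a T : ℝ} (hT : |2 * π * a * T| < π / 2)
    {F G : ℝ → ℂ} (hF : MemLp F 2) (hG : MemLp G 2) {R : ℝ} (hR : 0 ≤ R)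
    (hFR : ∀ u, R < |u| → F u = 0) (hGR : ∀ u, R < |u| → G u = 0)
    (hF' : MemLp (fun u => ((Real.exp (2 * π * T * u) : ℝ) : ℂ) * F u) 2)
    (hG' : MemLp (fun u => ((Real.exp (-(2 * π * T) * u) : ℝ) : ℂ) * G u) 2) :
    inner ℂ hG.toLp (lineMultiplier _ (memLp_complexSymbol hT left_mem_uIcc) hF.toLp) =
      inner ℂ hG'.toLp (lineMultiplier _ (memLp_complexSymbol hT right_mem_uIcc) hF'.toLp) := by
  have hFi : Integrable F := by simpa using (memLp_exp_mul hF hFR 0).2.1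
  have hGi : Integrable G := by simpa using (memLp_exp_mul hG hGR 0).2.1
  have dF := differentiable_complexFourier hFi hFR
  have dG := differentiable_complexFourier hGi hGR
  -- The double conjugation makes the factor coming from `G` holomorphic. At height `y` it evaluates
  -- the transform of `G` at height `-y`, hence the opposite weight on `G`.
  set Φ : ℂ → ℂ := fun z => complexSymbol a z * complexFourier F z *
    starRingEnd ℂ (complexFourier G (starRingEnd ℂ z)) with hΦ
  have hline : ∀ (η y : ℝ), Φ (η + y * I) = complexSymbol a (η + y * I) *
      complexFourier F (η + y * I) * starRingEnd ℂ (complexFourier G (η + (-y : ℝ) * I)) := by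
    intro η y
    simp [hΦ]
  have key : ∀ (y : ℝ) (hy : y ∈ uIcc 0 T)
      (h1 : MemLp (fun u => ((Real.exp (2 * π * y * u) : ℝ) : ℂ) * F u) 2)
      (h2 : MemLp (fun u => ((Real.exp (-(2 * π * y) * u) : ℝ) : ℂ) * G u) 2),
      inner ℂ h2.toLp (lineMultiplier _ (memLp_complexSymbol hT hy) h1.toLp) =
        ∫ η : ℝ, Φ (η + y * I) := by
    intro y hy h1 h2
    rw [← Lp.inner_fourier_eq, L2.inner_def]
    refine integral_congr_ae ?_
    filter_upwards [fourier_lineMultiplier _ (memLp_complexSymbol hT hy) h1.toLp,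
      fourier_toLp_ae_eq (memLp_exp_mul hF hFR _).2.1 h1,
      fourier_toLp_ae_eq (memLp_exp_mul hG hGR _).2.1 h2] with η e1 e2 e3
    rw [e1, e2, e3, hline, complexFourier_add_mul_I, complexFourier_add_mul_I, RCLike.inner_apply]
    simp only [mul_neg]
  have hshift : ∫ x : ℝ, Φ x = ∫ x : ℝ, Φ (x + T * I) := by
    set C : ℝ≥0∞ := ENNReal.ofReal (Real.cos (2 * π * a * T))⁻¹
    refine integral_eq_integral_add_of_bounded (B := C *
      (ENNReal.ofReal (Real.exp (2 * (|2 * π * T| * R))) * (∫⁻ u, ‖F u‖ₑ ^ 2) +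
        ENNReal.ofReal (Real.exp (2 * (|2 * π * T| * R))) * ∫⁻ u, ‖G u‖ₑ ^ 2)) ?_ ?_ ?_ ?_
    · rw [lintegral_sq_eq, lintegral_sq_eq]
      have := hF.2.ne
      have := hG.2.ne
      finiteness
    · refine ((differentiableOn_complexSymbol hT).mul dF.differentiableOn).mul ?_
      have h1 : Differentiable ℂ fun z => starRingEnd ℂ (complexFourier G (starRingEnd ℂ z)) :=
        fun z => by
          simpa only [Complex.conj_conj, Function.comp_def] using (dG (starRingEnd ℂ z)).conj_conj
      exact h1.differentiableOn
    · have := measurable_complexSymbol a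
      have := dF.continuous.measurable
      have := dG.continuous.measurable
      have h4 : Measurable (starRingEnd ℂ : ℂ → ℂ) := Complex.continuous_conj.measurable
      exact ((measurable_complexSymbol a).mul dF.continuous.measurable).mul
        (h4.comp (dG.continuous.measurable.comp h4))
    · intro y hy
      have hyT : |y| ≤ |T| := by simpa using abs_sub_left_of_mem_uIcc hy
      have hpt : ∀ η : ℝ, ‖Φ (η + y * I)‖ₑ ≤ C * (‖complexFourier F (η + y * I)‖ₑ ^ 2 +
          ‖complexFourier G (η + (-y : ℝ) * I)‖ₑ ^ 2) := fun η => by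
        rw [hline, mul_assoc, enorm_mul]
        have hc : ‖complexSymbol a (η + y * I)‖ₑ ≤ C := by
          rw [← ofReal_norm]
          exact ENNReal.ofReal_le_ofReal (norm_complexSymbol_le hT (by simpa using hy))
        refine mul_le_mul' hc ?_
        rw [enorm_mul, RCLike.enorm_conj]
        rcases le_total ‖complexFourier F (η + y * I)‖ₑ
          ‖complexFourier G (η + (-y : ℝ) * I)‖ₑ with h | h
        · refine le_trans ?_ le_add_self
          rw [sq]; gcongr
        · refine le_trans ?_ le_self_add
          rw [sq]; gcongr
      have hbd : ∀ {K : ℝ → ℂ}, MemLp K 2 → (∀ u, R < |u| → K u = 0) → ∀ t : ℝ, |t| ≤ |T| →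
          ∫⁻ η : ℝ, ‖complexFourier K (η + t * I)‖ₑ ^ 2 ≤
            ENNReal.ofReal (Real.exp (2 * (|2 * π * T| * R))) * ∫⁻ u, ‖K u‖ₑ ^ 2 := by
        intro K hK hKR t ht
        refine (lintegral_complexFourier_sq_le hK hKR t).trans ?_
        gcongr ENNReal.ofReal (Real.exp (2 * ?_)) * _
        rw [abs_mul, abs_mul (2 * π)]
        gcongr
      refine (lintegral_mono hpt).trans ?_
      have := dF.continuous.measurable
      rw [lintegral_const_mul' _ _ ENNReal.ofReal_ne_top, lintegral_add_left (by fun_prop)]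
      exact mul_le_mul_right (add_le_add (hbd hF hFR y hyT) (hbd hG hGR (-y) (by simpa using hyT))) _
  have hF0 : MemLp (fun u => ((Real.exp (2 * π * 0 * u) : ℝ) : ℂ) * F u) 2 := by simpa using hF
  have hG0 : MemLp (fun u => ((Real.exp (-(2 * π * 0) * u) : ℝ) : ℂ) * G u) 2 := by simpa using hG
  have h0 := key 0 left_mem_uIcc hF0 hG0
  rw [MemLp.toLp_congr hF0 hF (.of_forall fun u => by simp),
    MemLp.toLp_congr hG0 hG (.of_forall fun u => by simp)] at h0
  rw [h0, key T right_mem_uIcc hF' hG', ← hshift]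
  simp only [ofReal_zero, zero_mul, add_zero]

theorem truncate_coeFn (n : ℕ) (F : L2R) :
    truncate n F =ᵐ[volume] (Icc (-(n : ℝ)) n).indicator F :=
  MemLp.coeFn_toLp _

theorem indicator_Icc_eq_zero {n : ℕ} (F : ℝ → ℂ) (u : ℝ) (hu : (n : ℝ) < |u|) :
    (Icc (-(n : ℝ)) n).indicator F u = 0 :=
  indicator_of_notMem (s := Icc (-(n : ℝ)) n) (fun h => not_le.2 hu (abs_le.2 ⟨h.1, h.2⟩)) F

/-- Truncate `F` and `g` to `[-n, n]`, where the weight relation persists, and let `n → ∞`; the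
multipliers are continuous on `L²`. -/
theorem inner_lineMultiplier_eq {a T : ℝ} (hT : |2 * π * a * T| < π / 2)
    {F g : L2R} (hg : g =ᵐ[volume] fun u => ((exp (2 * π * T * u) : ℝ) : ℂ) * F u)
    {G : ℝ → ℂ} (hG : MemLp G 2) {n₀ : ℕ} (hGR : ∀ u, (n₀ : ℝ) < |u| → G u = 0)
    (hG' : MemLp (fun u => ((exp (-(2 * π * T) * u) : ℝ) : ℂ) * G u) 2) :
    inner ℂ hG.toLp (lineMultiplier _ (memLp_complexSymbol hT left_mem_uIcc) F) =
      inner ℂ hG'.toLp (lineMultiplier _ (memLp_complexSymbol hT right_mem_uIcc) g) := by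
  have hl := ((lineMultiplier _ (memLp_complexSymbol hT left_mem_uIcc)).continuous.tendsto F).comp
    (tendsto_truncate F)
  have hr := ((lineMultiplier _ (memLp_complexSymbol hT right_mem_uIcc)).continuous.tendsto g).comp
    (tendsto_truncate g)
  refine tendsto_nhds_unique_of_eventuallyEq (tendsto_const_nhds.inner hl)
    (tendsto_const_nhds.inner hr) ?_
  filter_upwards [eventually_ge_atTop n₀] with n hn
  have hFn := (Lp.memLp F).indicator (measurableSet_Icc (a := -(n : ℝ)) (b := n))
  have hF' := (memLp_exp_mul hFn (indicator_Icc_eq_zero F) (2 * π * T)).1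
  have h1 : truncate n g = hF'.toLp := by
    apply Lp.ext
    filter_upwards [truncate_coeFn n g, hF'.coeFn_toLp, hg] with u e1 e2 e3
    rw [e1, e2]
    by_cases hu : u ∈ Icc (-(n : ℝ)) n <;> simp [hu, e3]
  have h2 := inner_lineMultiplier_eq_of_bounded_support hT hFn hG (Nat.cast_nonneg n)
    (indicator_Icc_eq_zero F)
    (fun u hu => hGR u (lt_of_le_of_lt (by exact_mod_cast hn) hu)) hF' hG'
  simp only [Function.comp_apply]
  rw [h1]
  exact h2

/-- Multiplication by `e^{2πTu}` intertwines the multiplier with symbol `m_a` and the one whose symbol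
is `m_a` on the line of imaginary part `T`. -/
theorem lineMultiplier_exp_mul {a T : ℝ} (hT : |2 * π * a * T| < π / 2)
    {F g : L2R} (hg : g =ᵐ[volume] fun u => ((exp (2 * π * T * u) : ℝ) : ℂ) * F u) :
    lineMultiplier _ (memLp_complexSymbol hT right_mem_uIcc) g =ᵐ[volume] fun u =>
      ((exp (2 * π * T * u) : ℝ) : ℂ) *
        lineMultiplier _ (memLp_complexSymbol hT left_mem_uIcc) F u := by
  set H := lineMultiplier _ (memLp_complexSymbol hT left_mem_uIcc) F with hH
  set K := lineMultiplier _ (memLp_complexSymbol hT right_mem_uIcc) g with hK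
  set E : ℝ → ℂ := fun u => ((exp (-(2 * π * T) * u) : ℝ) : ℂ) with hE
  -- The duality identity is tested against `H - E K` itself, cut off to `[-n, n]`: the weight on
  -- the test function moves over to `K`, and the difference of the two sides is `∫ |G|²`.
  have hloc : ∀ n : ℕ, ∀ᵐ u : ℝ, u ∈ Icc (-(n : ℝ)) n → H u - E u * K u = 0 := by
    intro n
    have hK1 := (Lp.memLp K).indicator (measurableSet_Icc (a := -(n : ℝ)) (b := n))
    have hEK := (memLp_exp_mul hK1 (indicator_Icc_eq_zero K) (-(2 * π * T))).1
    have hG : MemLp ((Icc (-(n : ℝ)) n).indicator fun u => H u - E u * K u) 2 := by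
      refine (((Lp.memLp H).indicator (measurableSet_Icc (a := -(n : ℝ)) (b := n))).sub hEK).ae_eq
        (.of_forall fun u => ?_)
      by_cases hu : u ∈ Icc (-(n : ℝ)) n <;> simp [hu, hE]
    set G := (Icc (-(n : ℝ)) n).indicator fun u => H u - E u * K u with hGdef
    have hG' := (memLp_exp_mul hG (indicator_Icc_eq_zero _) (-(2 * π * T))).1
    have h1 := inner_lineMultiplier_eq hT hg hG (indicator_Icc_eq_zero _) hG'
    rw [← hH, ← hK, L2.inner_def, L2.inner_def, ← sub_eq_zero,
      ← integral_sub (L2.integrable_inner _ _) (L2.integrable_inner _ _)] at h1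
    have h2 : (fun u => inner ℂ (hG.toLp _ u) (H u) - inner ℂ (hG'.toLp _ u) (K u)) =ᵐ[volume]
        fun u => ((‖G u‖ ^ 2 : ℝ) : ℂ) := by
      filter_upwards [hG.coeFn_toLp, hG'.coeFn_toLp] with u e1 e2
      rw [e1, e2, RCLike.inner_apply, RCLike.inner_apply, map_mul, Complex.conj_ofReal,
        Complex.ofReal_pow, ← Complex.mul_conj']
      by_cases hu : u ∈ Icc (-(n : ℝ)) n
      · simp only [hGdef, indicator_of_mem hu, hE]
        ring
      · simp [hGdef, hu]
    rw [integral_congr_ae h2, integral_complex_ofReal, Complex.ofReal_eq_zero,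
      integral_eq_zero_iff_of_nonneg (fun u => sq_nonneg _)
        ((memLp_two_iff_integrable_sq_norm hG.1).1 hG)] at h1
    filter_upwards [h1] with u e hu
    have : G u = 0 := by simpa using e
    rwa [hGdef, indicator_of_mem hu] at this
  filter_upwards [ae_all_iff.2 hloc] with u hu
  obtain ⟨n, hn⟩ := exists_nat_ge |u|
  have h1 := hu n (abs_le.1 hn)
  rw [sub_eq_zero.1 h1, hE, ← mul_assoc, ← Complex.ofReal_mul, ← exp_add]
  simp

/-! ### The one-dimensional estimate -/

theorem gagliardo_univ_congr_ae (s : ℝ) {φ ψ : ℝ → ℂ} (h : φ =ᵐ[volume] ψ) :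
    gagliardo s univ φ = gagliardo s univ ψ := by
  simp only [gagliardo, Measure.restrict_univ]
  refine lintegral_congr_ae ?_
  filter_upwards [h] with x hx
  refine lintegral_congr_ae ?_
  filter_upwards [h] with y hy
  rw [hx, hy]

theorem logGagliardo_congr_ae (s : ℝ) {g₁ g₂ : ℝ → ℂ} (h : g₁ =ᵐ[volume] g₂) :
    logGagliardo s g₁ = logGagliardo s g₂ := by
  rw [logGagliardo, logGagliardo]
  congr 1; ext t
  rw [logDiff, logDiff]
  congr 1
  refine lintegral_congr_ae ?_
  filter_upwards [h, (measurePreserving_add_right volume t).quasiMeasurePreserving.ae h]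
    with v h1 h2
  rw [h1, h2]

/-- The one-dimensional operator is `φ ↦ ψ`, through `F` in logarithmic coordinates and its
multiplier image `H`. The seminorm of `ψ` is controlled through the shifted multiplier applied to
`e^{-su} F`, and the Hardy inequality for the input also pays for the extension of the output by
zero. -/
theorem exists_homogeneous_bound {a s : ℝ} (hs0 : 0 < s) (hs : s < 1 / 2)
    (has : |a| * s < π / 2) : ∃ C : ℝ≥0∞, C ≠ ∞ ∧ ∀ φ ψ F H : L2R,
      (F =ᵐ[volume] fun u => ((exp (u / 2) : ℝ) : ℂ) * φ (exp u)) →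
      ((𝓕 H : L2R) =ᵐ[volume] fun η => (symbol a (2 * π * η) : ℂ) * (𝓕 F : L2R) η) →
      (ψ =ᵐ[volume] (Ioi 0).indicator fun x => ((exp (-log x / 2) : ℝ) : ℂ) * H (log x)) →
      ∫⁻ η, ENNReal.ofReal (|η| ^ (2 * s)) * ‖(𝓕 ψ : L2R) η‖ₑ ^ 2 ≤
        C * ∫⁻ η, ENNReal.ofReal (|η| ^ (2 * s)) * ‖(𝓕 φ : L2R) η‖ₑ ^ 2 := by
  obtain ⟨A, hA0, hA⟩ := exists_hardy hs
  -- Chosen so that `e^{2πTu} = e^{-su}`, the factor relating `F` to `g₀`.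
  set T : ℝ := -s / (2 * π) with hTdef
  have h2T : 2 * π * T = -s := by rw [hTdef]; field_simp
  have hT : |2 * π * a * T| < π / 2 := by
    rw [show 2 * π * a * T = a * -s by rw [← h2T]; ring, abs_mul, abs_neg, abs_of_pos hs0]
    exact has
  set M : ℝ≥0∞ := ENNReal.ofReal (cos (2 * π * a * T))⁻¹ with hM
  have hMtop : M ≠ ∞ := ENNReal.ofReal_ne_top
  refine ⟨M ^ 2 * (1 + ENNReal.ofReal (1 / s) * A⁻¹), by finiteness, ?_⟩
  intro φ ψ F H hF hH hψ
  set X := ∫⁻ η, ENNReal.ofReal (|η| ^ (2 * s)) * ‖(𝓕 φ : L2R) η‖ₑ ^ 2 with hX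
  by_cases hXtop : X = ∞
  · have hM0 : M ≠ 0 := by
      rw [hM, ne_eq, ENNReal.ofReal_eq_zero, not_le]
      exact inv_pos.2 (cos_pos_of_abs_lt hT)
    rw [hXtop, ENNReal.mul_top (mul_ne_zero (pow_ne_zero _ hM0) (by simp))]
    exact le_top
  have hφm := (Lp.stronglyMeasurable φ).measurable
  have hHm := (Lp.stronglyMeasurable H).measurable
  set g₀ : ℝ → ℂ := fun v => ((exp ((1 / 2 - s) * v) : ℝ) : ℂ) * φ (exp v) with hg₀
  have hg₀m : Measurable g₀ := by fun_prop
  have hg₀F : g₀ =ᵐ[volume] fun u => ((exp (2 * π * T * u) : ℝ) : ℂ) * F u := by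
    filter_upwards [hF] with u hu
    rw [hu, ← mul_assoc, ← Complex.ofReal_mul, ← exp_add, h2T, hg₀]
    dsimp only
    congr 4; ring
  have hK := gagliardo_mono s (subset_univ (Ioi 0)) φ
  rw [gagliardo_univ_eq_fourier, ← hX, ← logGagliardo_eq s hφm, ← hg₀] at hK
  have hCtop := gagConst_ne_top hs0 (hs.trans (by norm_num))
  -- On `(R, ∞)` the factor `e^{-sv}` is bounded and `F` is in `L²`. Towards `-∞` it grows, and
  -- there only the Hardy inequality gives integrability.
  have htail : ∀ R : ℝ, ∫⁻ v in Ioi R, ‖g₀ v‖ₑ ^ 2 ≠ ∞ := fun R => by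
    have h1 : ∀ᵐ v ∂volume.restrict (Ioi R), ‖g₀ v‖ₑ ^ 2 ≤
        ENNReal.ofReal (exp (2 * (-s * R))) * ‖F v‖ₑ ^ 2 := by
      filter_upwards [ae_restrict_of_ae hg₀F, ae_restrict_mem measurableSet_Ioi] with v hv hvR
      rw [hv, h2T, enorm_mul, mul_pow, enorm_ofReal_exp_sq]
      gcongr ENNReal.ofReal (exp (2 * ?_)) * _
      have : R < v := hvR
      nlinarith
    refine ((lintegral_mono_ae h1).trans (setLIntegral_le_lintegral _ _)).trans_lt ?_ |>.ne
    rw [lintegral_const_mul' _ _ ENNReal.ofReal_ne_top, lintegral_sq_eq]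
    exact ENNReal.mul_lt_top ENNReal.ofReal_lt_top (ENNReal.pow_lt_top (Lp.eLpNorm_lt_top F))
  have hHardy : ∫⁻ v, ‖g₀ v‖ₑ ^ 2 ≤ A⁻¹ * logGagliardo s g₀ := by
    -- The constant `A` is known only to be nonzero. If it were infinite, then `A⁻¹ = 0`, and
    -- finiteness of the seminorm forces the integral to vanish as well.
    rcases eq_or_ne A ∞ with hAt | hAt
    · have h1 := hA g₀ hg₀m htail
      have h2 : logGagliardo s g₀ ≠ ∞ := (hK.trans_lt (by finiteness)).ne
      rw [hAt] at h1
      have h3 : ∫⁻ v, ‖g₀ v‖ₑ ^ 2 = 0 := by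
        by_contra h0
        rw [ENNReal.top_mul h0] at h1
        exact h2 (top_le_iff.1 h1)
      rw [h3]; exact zero_le
    · rw [mul_comm, ← div_eq_mul_inv, ENNReal.le_div_iff_mul_le (.inl hA0) (.inl hAt), mul_comm]
      exact hA g₀ hg₀m htail
  have hg₀L : MemLp g₀ 2 := by
    refine ⟨hg₀m.aestronglyMeasurable, ?_⟩
    have h1 : ∫⁻ v, ‖g₀ v‖ₑ ^ 2 < ∞ :=
      hHardy.trans_lt (ENNReal.mul_lt_top (by simpa [pos_iff_ne_zero] using hA0)
        (hK.trans_lt (by finiteness)))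
    rw [lintegral_sq_eq] at h1
    simpa using h1
  set g : L2R := hg₀L.toLp with hg
  have hgg₀ : g =ᵐ[volume] g₀ := hg₀L.coeFn_toLp
  set K : L2R := lineMultiplier _ (memLp_complexSymbol hT right_mem_uIcc) g with hKdef
  have hHeq : H = lineMultiplier _ (memLp_complexSymbol hT left_mem_uIcc) F := by
    apply (Lp.fourierTransformₗᵢ ℝ ℂ).injective
    apply Lp.ext
    refine hH.trans ?_
    filter_upwards [fourier_lineMultiplier _ (memLp_complexSymbol hT left_mem_uIcc) F] with η hη
    refine Eq.trans ?_ hη.symm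
    rw [symbol_two_pi_mul]
    simp
  have hKH : K =ᵐ[volume] fun u => ((exp (2 * π * T * u) : ℝ) : ℂ) * H u := by
    rw [hHeq]
    exact lineMultiplier_exp_mul hT (hgg₀.trans hg₀F)
  have hKM : ∀ᵐ η, ‖(𝓕 K : L2R) η‖ₑ ≤ M * ‖(𝓕 g : L2R) η‖ₑ := by
    filter_upwards [fourier_lineMultiplier _ (memLp_complexSymbol hT right_mem_uIcc) g] with η hη
    rw [hη, enorm_mul]
    gcongr
    rw [← ofReal_norm]
    exact ENNReal.ofReal_le_ofReal (norm_complexSymbol_le hT (by simp))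
  set ψ₀ : ℝ → ℂ := (Ioi 0).indicator fun x => ((exp (-log x / 2) : ℝ) : ℂ) * H (log x) with hψ₀
  have hψ₀m : Measurable ψ₀ := Measurable.indicator (by fun_prop) measurableSet_Ioi
  -- `K` stands to the output `ψ₀` as `g₀` stands to the input `φ`.
  have hψ₀K : (fun v => ((exp ((1 / 2 - s) * v) : ℝ) : ℂ) * ψ₀ (exp v)) =ᵐ[volume] K := by
    filter_upwards [hKH] with v hv
    rw [hv, hψ₀, indicator_of_mem (show exp v ∈ Ioi (0 : ℝ) from exp_pos v), log_exp, ← mul_assoc, ← Complex.ofReal_mul,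
      ← exp_add, h2T]
    congr 4; ring
  have hKnorm : ∫⁻ v, ‖K v‖ₑ ^ 2 ≤ M ^ 2 * ∫⁻ v, ‖g₀ v‖ₑ ^ 2 := by
    have hgn : ∫⁻ v, ‖g v‖ₑ ^ 2 = ∫⁻ v, ‖g₀ v‖ₑ ^ 2 :=
      lintegral_congr_ae (hgg₀.fun_comp fun z => ‖z‖ₑ ^ 2)
    rw [← hgn]
    refine le_trans (le_of_eq (lintegral_fourier_sq K).symm) ?_
    refine le_trans ?_ (le_of_eq (congrArg _ (lintegral_fourier_sq g)))
    rw [← lintegral_const_mul' _ _ (by finiteness)]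
    refine lintegral_mono_ae ?_
    filter_upwards [hKM] with η hη
    rw [← mul_pow]
    gcongr
  have hfinal : gagliardo s univ ψ ≤ M ^ 2 * (1 + ENNReal.ofReal (1 / s) * A⁻¹) *
      (gagConst s * X) := by
    calc gagliardo s univ ψ = gagliardo s univ ψ₀ := gagliardo_univ_congr_ae s hψ
      _ ≤ gagliardo s (Ioi 0) ψ₀ + ENNReal.ofReal (1 / s) *
          ∫⁻ x in Ioi 0, ENNReal.ofReal (x ^ (-(2 * s))) * ‖ψ₀ x‖ₑ ^ 2 :=
        gagliardo_univ_le_of_eq_zero hs0 hψ₀m fun x hx => indicator_of_notMem (by simpa using hx) _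
      _ = logGagliardo s K + ENNReal.ofReal (1 / s) * ∫⁻ v, ‖K v‖ₑ ^ 2 := by
        rw [lintegral_rpow_mul_sq, ← logGagliardo_eq s hψ₀m, logGagliardo_congr_ae s hψ₀K]
        congr 2
        exact lintegral_congr_ae (hψ₀K.fun_comp fun z => ‖z‖ₑ ^ 2)
      _ ≤ M ^ 2 * logGagliardo s g₀ + ENNReal.ofReal (1 / s) *
          (M ^ 2 * (A⁻¹ * logGagliardo s g₀)) := by
        gcongr
        · exact (logGagliardo_le_of_fourier_le s hMtop hKM).trans_eq
            (by rw [logGagliardo_congr_ae s hgg₀])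
        · exact hKnorm.trans (by gcongr)
      _ = M ^ 2 * (1 + ENNReal.ofReal (1 / s) * A⁻¹) * logGagliardo s g₀ := by ring
      _ ≤ _ := by gcongr
  -- Both seminorms carry the factor `gagConst s`, which is neither zero nor infinite and cancels.
  rw [gagliardo_univ_eq_fourier, mul_left_comm] at hfinal
  exact (ENNReal.mul_le_mul_iff_right (gagConst_ne_zero s) hCtop).1 hfinal

/-! ### The case `s = 0` -/

/-- The weighted change of variables behind `C2` pulls null sets back to null sets wherever the
weight is nonzero, and `e^{u/2}` never vanishes. -/
theorem ae_exp {P : ℝ → Prop} (h : ∀ᵐ x : ℝ, P x) : ∀ᵐ u : ℝ, P (exp u) := by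
  have h1 := ae_weighted_comp (w := fun u : ℝ => ((exp (u / 2) : ℝ) : ℂ)) (φ := exp)
    (μ := volume.restrict (Ioi (0 : ℝ))) (ν := volume) (by fun_prop) (by fun_prop)
    (fun g _ => by simp_rw [enorm_exp_half]; exact (lintegral_exp_change g).symm)
    (ae_restrict_of_ae h)
  filter_upwards [h1] with u hu
  exact hu.resolve_left (by simp)

theorem lintegral_log_change (g : ℝ → ℝ≥0∞) :
    ∫⁻ x in Ioi (0 : ℝ), ‖((exp (-log x / 2) : ℝ) : ℂ)‖ₑ ^ 2 * g (log x) = ∫⁻ u, g u := by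
  rw [lintegral_exp_change]
  congr 1; ext u
  rw [enorm_exp_half, log_exp, ← mul_assoc, ← ENNReal.ofReal_mul (exp_pos _).le, ← exp_add]
  simp

theorem ae_log {P : ℝ → Prop} (h : ∀ᵐ u : ℝ, P u) : ∀ᵐ x ∂volume.restrict (Ioi (0 : ℝ)), P (log x) := by
  have h1 := ae_weighted_comp (w := fun x : ℝ => ((exp (-log x / 2) : ℝ) : ℂ)) (φ := log)
    (μ := volume) (ν := volume.restrict (Ioi (0 : ℝ))) (by fun_prop) (by fun_prop)
    (fun g _ => lintegral_log_change g) h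
  filter_upwards [h1] with u hu
  exact hu.resolve_left (by simp)

theorem symbol_mem_Icc (a ξ : ℝ) : symbol a ξ ∈ Icc (0 : ℝ) 1 := by
  have hc := Real.cosh_pos (a * ξ)
  refine ⟨by unfold symbol; positivity, ?_⟩
  rw [symbol, div_le_one (by positivity), Real.cosh_eq]
  have := Real.exp_pos (-(a * ξ))
  linarith

/-- The logarithmic substitution and its inverse are isometries, restriction to the half line is a
contraction, and so is the multiplier because `0 ≤ m_a ≤ 1`. -/
theorem lintegral_fourier_sq_le {a : ℝ} {φ ψ F H : L2R}
    (hF : F =ᵐ[volume] fun u => ((exp (u / 2) : ℝ) : ℂ) * φ (exp u))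
    (hH : (𝓕 H : L2R) =ᵐ[volume] fun η => (symbol a (2 * π * η) : ℂ) * (𝓕 F : L2R) η)
    (hψ : ψ =ᵐ[volume] (Ioi 0).indicator fun x => ((exp (-log x / 2) : ℝ) : ℂ) * H (log x)) :
    ∫⁻ η, ‖(𝓕 ψ : L2R) η‖ₑ ^ 2 ≤ ∫⁻ η, ‖(𝓕 φ : L2R) η‖ₑ ^ 2 := by
  calc ∫⁻ η, ‖(𝓕 ψ : L2R) η‖ₑ ^ 2 = ∫⁻ x, ‖ψ x‖ₑ ^ 2 := lintegral_fourier_sq ψ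
    _ = ∫⁻ x in Ioi (0 : ℝ), ‖((exp (-log x / 2) : ℝ) : ℂ)‖ₑ ^ 2 * ‖H (log x)‖ₑ ^ 2 := by
      rw [← lintegral_indicator measurableSet_Ioi]
      refine lintegral_congr_ae ?_
      filter_upwards [hψ] with x hx
      rw [hx]
      by_cases h : x ∈ Ioi (0 : ℝ) <;> simp [indicator, h, mul_pow]
    _ = ∫⁻ u, ‖H u‖ₑ ^ 2 := lintegral_log_change fun u => ‖H u‖ₑ ^ 2
    _ = ∫⁻ η, ‖(𝓕 H : L2R) η‖ₑ ^ 2 := (lintegral_fourier_sq H).symm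
    _ ≤ ∫⁻ η, ‖(𝓕 F : L2R) η‖ₑ ^ 2 := by
      refine lintegral_mono_ae ?_
      filter_upwards [hH] with η hη
      rw [hη, enorm_mul]
      gcongr
      refine mul_le_of_le_one_left' ?_
      rw [← ofReal_norm, Complex.norm_real, Real.norm_eq_abs,
        abs_of_nonneg (symbol_mem_Icc a _).1]
      exact ENNReal.ofReal_le_one.2 (symbol_mem_Icc a _).2
    _ = ∫⁻ u, ‖F u‖ₑ ^ 2 := lintegral_fourier_sq F
    _ = ∫⁻ x in Ioi 0, ‖φ x‖ₑ ^ 2 := by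
      rw [lintegral_exp_change]
      refine lintegral_congr_ae ?_
      filter_upwards [hF] with u hu
      rw [hu, enorm_mul, mul_pow, enorm_exp_half]
    _ ≤ ∫⁻ x, ‖φ x‖ₑ ^ 2 := setLIntegral_le_lintegral _ _
    _ = ∫⁻ η, ‖(𝓕 φ : L2R) η‖ₑ ^ 2 := (lintegral_fourier_sq φ).symm

/-! ### Reduction of `P_a` to the one-dimensional operators -/

theorem torusCoeffL2_coeFn (f : L2RT) (j : ℤ) : torusCoeffL2 f j =ᵐ[volume] torusCoeff f j :=
  (memLp_torusCoeff f j).coeFn_toLp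

/-- Angular integration commutes with restriction, substitution and weights in `x` alone. This and
the two lemmas after it provide the three relations assumed in `exists_homogeneous_bound`. -/
theorem torusCoeffL2_C2_restrictPos (f : L2RT) (j : ℤ) :
    torusCoeffL2 (C2 (restrictPos f)) j =ᵐ[volume] fun u =>
      ((exp (u / 2) : ℝ) : ℂ) * torusCoeffL2 f j (exp u) := by
  have h1 : (restrictPos f : ℝ × Torus → ℂ) =ᵐ[halfMeasure] f :=
    LpToLpRestrictCLM_coeFn ℂ (Ioi (0 : ℝ) ×ˢ univ) f
  have h2 := ae_weighted_comp (by fun_prop) (by fun_prop) lintegral_logChange h1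
  have h3 : ∀ᵐ p : ℝ × Torus, C2 (restrictPos f) p =
      ((exp (p.1 / 2) : ℝ) : ℂ) * f (exp p.1, p.2) := by
    filter_upwards [C2_coeFn (restrictPos f), h2] with p hp hp2
    rw [hp, hp2.resolve_left (by simp)]
  filter_upwards [torusCoeffL2_coeFn (C2 (restrictPos f)) j, ae_exp (torusCoeffL2_coeFn f j),
    ae_ae_RT h3] with u hu1 hu2 hu3
  rw [hu1, hu2, torusCoeff, torusCoeff, ← integral_const_mul]
  refine integral_congr_ae ?_
  filter_upwards [hu3] with θ hθ
  rw [hθ]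
  ring

theorem fourier_torusCoeffL2_multiplierOp {a : ℝ} (f : L2RT) (j : ℤ) :
    (𝓕 (torusCoeffL2 (multiplierOp (fun p => (symbol a p.1 : ℂ)) (memLp_symbol a) f) j) : L2R)
      =ᵐ[volume] fun η => (symbol a (2 * π * η) : ℂ) * (𝓕 (torusCoeffL2 f j) : L2R) η := by
  set Tf := multiplierOp (fun p => (symbol a p.1 : ℂ)) (memLp_symbol a) f with hTf
  have h1 : fourierRT Tf = (ContinuousLinearMap.mul ℂ ℂ).holderL dualMeasure ∞ 2 2
      (memLp_symbol a).toLp (fourierRT f) := fourierRT.apply_symm_apply _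
  have h2 : fourierFun Tf =ᵐ[dualMeasure] fun p => (symbol a p.1 : ℂ) * fourierFun f p := by
    filter_upwards [fourierRT_coeFn Tf, fourierRT_coeFn f, (memLp_symbol a).coeFn_toLp,
      (ContinuousLinearMap.mul ℂ ℂ).coeFn_holder (r := 2) (memLp_symbol a).toLp (fourierRT f)]
      with p e1 e2 e3 e4
    rw [← e1, ← e2, h1]
    refine e4.trans ?_
    rw [e3]
    rfl
  have h3 := ae_dual_iff.1 h2 j
  have hq : Measure.QuasiMeasurePreserving (fun η : ℝ => 2 * π * η) := by
    refine ⟨by fun_prop, ?_⟩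
    rw [Real.map_volume_mul_left (by positivity)]
    exact Measure.smul_absolutelyContinuous
  filter_upwards [hq.ae h3] with η hη
  simp only [fourierFun] at hη
  rwa [mul_div_cancel_left₀ _ Real.two_pi_pos.ne'] at hη

theorem torusCoeffL2_extendPos_C2_symm (g : L2RT) (j : ℤ) :
    torusCoeffL2 (extendPos (C2.symm g)) j =ᵐ[volume] (Ioi 0).indicator fun x =>
      ((exp (-log x / 2) : ℝ) : ℂ) * torusCoeffL2 g j (log x) := by
  have h1 : extendPos (C2.symm g) =ᵐ[volume] fun p =>
      (Ioi (0 : ℝ) ×ˢ (univ : Set Torus)).indicator 1 p * C2.symm g p :=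
    weightedComp_coeFn _ _ _ _ _ _
  have h2 := (ae_restrict_iff' measurableSet_half).1 (C2_symm_coeFn g)
  have h3 : ∀ᵐ p : ℝ × Torus, extendPos (C2.symm g) p =
      (Ioi (0 : ℝ)).indicator (fun _ => ((exp (-log p.1 / 2) : ℝ) : ℂ) * g (log p.1, p.2)) p.1 := by
    filter_upwards [h1, h2] with p e1 e2
    rw [e1]
    by_cases hp : p.1 ∈ Ioi (0 : ℝ)
    · have hp' : p ∈ Ioi (0 : ℝ) ×ˢ (univ : Set Torus) := ⟨hp, mem_univ _⟩
      rw [indicator_of_mem hp', indicator_of_mem hp, e2 hp']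
      simp
    · rw [indicator_of_notMem fun h => hp h.1, indicator_of_notMem hp, zero_mul]
  have h4 := (ae_restrict_iff' measurableSet_Ioi).1 (ae_log (torusCoeffL2_coeFn g j))
  filter_upwards [torusCoeffL2_coeFn (extendPos (C2.symm g)) j, ae_ae_RT h3, h4] with x e1 e2 e3
  rw [e1, torusCoeff]
  by_cases hx : x ∈ Ioi (0 : ℝ)
  · rw [indicator_of_mem hx, e3 hx, torusCoeff, ← integral_const_mul]
    refine integral_congr_ae ?_
    filter_upwards [e2] with θ hθ
    rw [hθ, indicator_of_mem hx]
    ring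
  · rw [indicator_of_notMem hx]
    rw [integral_eq_zero_of_ae]
    filter_upwards [e2] with θ hθ
    rw [hθ, indicator_of_notMem hx, mul_zero, Pi.zero_apply]

theorem opP_apply (a : ℝ) (f : L2RT) : opP a f = extendPos (C2.symm
    (multiplierOp (fun p => (symbol a p.1 : ℂ)) (memLp_symbol a) (C2 (restrictPos f)))) :=
  rfl

theorem slice_l2_bound (a : ℝ) (f : L2RT) (j : ℤ) :
    ∫⁻ η, ‖(𝓕 (torusCoeffL2 (opP a f) j) : L2R) η‖ₑ ^ 2 ≤
      ∫⁻ η, ‖(𝓕 (torusCoeffL2 f j) : L2R) η‖ₑ ^ 2 := by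
  rw [opP_apply]
  exact lintegral_fourier_sq_le (torusCoeffL2_C2_restrictPos f j)
    (fourier_torusCoeffL2_multiplierOp _ j) (torusCoeffL2_extendPos_C2_symm _ j)

theorem exists_slice_bound {a s : ℝ} (hs0 : 0 ≤ s) (hs : s < 1 / 2) (has : |a| * s < π / 2) :
    ∃ C : ℝ≥0∞, C ≠ ∞ ∧ ∀ (f : L2RT) (j : ℤ),
      ∫⁻ η, ENNReal.ofReal (|η| ^ (2 * s)) * ‖(𝓕 (torusCoeffL2 (opP a f) j) : L2R) η‖ₑ ^ 2 ≤
        C * ∫⁻ η, ENNReal.ofReal (|η| ^ (2 * s)) * ‖(𝓕 (torusCoeffL2 f j) : L2R) η‖ₑ ^ 2 := by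
  rcases hs0.eq_or_lt with rfl | hs0
  · refine ⟨1, by simp, fun f j => ?_⟩
    simpa only [mul_zero, Real.rpow_zero, ENNReal.ofReal_one, one_mul] using slice_l2_bound a f j
  · obtain ⟨C, hC, h⟩ := exists_homogeneous_bound hs0 hs has
    refine ⟨C, hC, fun f j => ?_⟩
    rw [opP_apply]
    exact h _ _ _ _ (torusCoeffL2_C2_restrictPos f j)
      (fourier_torusCoeffL2_multiplierOp _ j) (torusCoeffL2_extendPos_C2_symm _ j)

/-! ### The Sobolev norm by slices -/

theorem measurable_weight (s : ℝ) : Measurable (weight s) := by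
  unfold weight
  have : Measurable fun p : ℝ × ℤ => (p.2 : ℝ) := (measurable_of_countable _).comp measurable_snd
  fun_prop

/-- The substitution `ξ = 2πη` accounts for the factor `2π`. -/
theorem lintegral_weight_fourierRT (s : ℝ) (f : L2RT) :
    ∫⁻ p, ‖(weight s p : ℂ) * fourierRT f p‖ₑ ^ 2 ∂dualMeasure =
      ∑' j : ℤ, ENNReal.ofReal (2 * π) * ∫⁻ η : ℝ,
        ENNReal.ofReal ((1 + (j : ℝ) ^ 2 + (2 * π * η) ^ 2) ^ s) *
          ‖(𝓕 (torusCoeffL2 f j) : L2R) η‖ₑ ^ 2 := by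
  have hw := measurable_weight s
  have hf := measurable_fourierFun f
  have h1 : ∫⁻ p, ‖(weight s p : ℂ) * fourierRT f p‖ₑ ^ 2 ∂dualMeasure =
      ∫⁻ p, ‖(weight s p : ℂ) * fourierFun f p‖ₑ ^ 2 ∂dualMeasure := by
    refine lintegral_congr_ae ?_
    filter_upwards [fourierRT_coeFn f] with p hp
    rw [hp]
  rw [h1, lintegral_dual (by fun_prop)]
  congr 1; ext j
  have hm := (Lp.stronglyMeasurable (𝓕 (torusCoeffL2 f j) : L2R)).measurable
  rw [← lintegral_div_two_pi (by fun_prop)]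
  congr 1; ext x
  rw [enorm_mul, mul_pow, fourierFun, mul_div_cancel₀ _ Real.two_pi_pos.ne']
  congr 1
  rw [← ofReal_norm, ← ENNReal.ofReal_pow (norm_nonneg _), Complex.norm_real, Real.norm_eq_abs,
    sq_abs, weight, ← Real.rpow_mul_natCast (by positivity)]
  congr 1
  push_cast
  congr 1 <;> ring

/-- On each slice the weight is at most `(1 + j²)^s + |2πη|^{2s}`, and each summand is at most the
weight. The `L²` bound with constant `1` and the homogeneous bound with constant `C` thus combine to
`1 + C`, independent of `j`, and the slices can be summed. -/
theorem exists_weight_bound {a s : ℝ} (hs0 : 0 ≤ s) (hs : s < 1 / 2) (has : |a| * s < π / 2) :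
    ∃ C : ℝ≥0∞, C ≠ ∞ ∧ ∀ f : L2RT,
      ∫⁻ p, ‖(weight s p : ℂ) * fourierRT (opP a f) p‖ₑ ^ 2 ∂dualMeasure ≤
        C * ∫⁻ p, ‖(weight s p : ℂ) * fourierRT f p‖ₑ ^ 2 ∂dualMeasure := by
  obtain ⟨C, hC, h⟩ := exists_slice_bound hs0 hs has
  refine ⟨1 + C, by finiteness, fun f => ?_⟩
  rw [lintegral_weight_fourierRT, lintegral_weight_fourierRT, ← ENNReal.tsum_mul_left]
  refine ENNReal.tsum_le_tsum fun j => ?_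
  rw [mul_left_comm]
  gcongr
  have hmP := (Lp.stronglyMeasurable (𝓕 (torusCoeffL2 (opP a f) j) : L2R)).measurable
  set A : ℝ := 1 + (j : ℝ) ^ 2 with hA
  have hA0 : 0 < A := by positivity
  have hB : ∀ η : ℝ, ((2 * π * η) ^ 2) ^ s = (2 * π) ^ (2 * s) * |η| ^ (2 * s) := fun η => by
    rw [← sq_abs, abs_mul, abs_of_pos Real.two_pi_pos, ← Real.rpow_natCast,
      ← Real.rpow_mul (by positivity), Real.mul_rpow (by positivity) (by positivity)]
    norm_num
  have hupper : ∀ η : ℝ, ENNReal.ofReal ((A + (2 * π * η) ^ 2) ^ s) ≤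
      ENNReal.ofReal (A ^ s) +
        ENNReal.ofReal ((2 * π) ^ (2 * s)) * ENNReal.ofReal (|η| ^ (2 * s)) := fun η => by
    rw [← ENNReal.ofReal_mul (by positivity), ← hB,
      ← ENNReal.ofReal_add (by positivity) (by positivity)]
    exact ENNReal.ofReal_le_ofReal
      (Real.rpow_add_le_add_rpow hA0.le (by positivity) hs0 (by linarith))
  have hlow1 : ∀ η : ℝ, ENNReal.ofReal (A ^ s) ≤ ENNReal.ofReal ((A + (2 * π * η) ^ 2) ^ s) :=
    fun η => ENNReal.ofReal_le_ofReal
      (Real.rpow_le_rpow hA0.le (le_add_of_nonneg_right (by positivity)) hs0)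
  have hlow2 : ∀ η : ℝ, ENNReal.ofReal ((2 * π) ^ (2 * s)) * ENNReal.ofReal (|η| ^ (2 * s)) ≤
      ENNReal.ofReal ((A + (2 * π * η) ^ 2) ^ s) := fun η => by
    rw [← ENNReal.ofReal_mul (by positivity), ← hB]
    exact ENNReal.ofReal_le_ofReal
      (Real.rpow_le_rpow (by positivity) (le_add_of_nonneg_left hA0.le) hs0)
  calc _ ≤ ∫⁻ η : ℝ, (ENNReal.ofReal (A ^ s) * ‖(𝓕 (torusCoeffL2 (opP a f) j) : L2R) η‖ₑ ^ 2 +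
        ENNReal.ofReal ((2 * π) ^ (2 * s)) * (ENNReal.ofReal (|η| ^ (2 * s)) *
          ‖(𝓕 (torusCoeffL2 (opP a f) j) : L2R) η‖ₑ ^ 2)) := by
        refine lintegral_mono fun η => ?_
        rw [← mul_assoc, ← add_mul]
        gcongr
        exact hupper η
    _ = ENNReal.ofReal (A ^ s) * (∫⁻ η : ℝ, ‖(𝓕 (torusCoeffL2 (opP a f) j) : L2R) η‖ₑ ^ 2) +
        ENNReal.ofReal ((2 * π) ^ (2 * s)) * ∫⁻ η : ℝ, ENNReal.ofReal (|η| ^ (2 * s)) *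
          ‖(𝓕 (torusCoeffL2 (opP a f) j) : L2R) η‖ₑ ^ 2 := by
        rw [lintegral_add_left (by fun_prop), lintegral_const_mul' _ _ ENNReal.ofReal_ne_top,
          lintegral_const_mul' _ _ ENNReal.ofReal_ne_top]
    _ ≤ ENNReal.ofReal (A ^ s) * (∫⁻ η : ℝ, ‖(𝓕 (torusCoeffL2 f j) : L2R) η‖ₑ ^ 2) +
        ENNReal.ofReal ((2 * π) ^ (2 * s)) * (C * ∫⁻ η : ℝ, ENNReal.ofReal (|η| ^ (2 * s)) *
          ‖(𝓕 (torusCoeffL2 f j) : L2R) η‖ₑ ^ 2) := by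
        exact add_le_add (mul_le_mul_right (slice_l2_bound a f j) _)
          (mul_le_mul_right (h f j) _)
    _ = (∫⁻ η : ℝ, ENNReal.ofReal (A ^ s) * ‖(𝓕 (torusCoeffL2 f j) : L2R) η‖ₑ ^ 2) +
        C * ∫⁻ η : ℝ, ENNReal.ofReal ((2 * π) ^ (2 * s)) * ENNReal.ofReal (|η| ^ (2 * s)) *
          ‖(𝓕 (torusCoeffL2 f j) : L2R) η‖ₑ ^ 2 := by
        simp_rw [mul_assoc]
        rw [lintegral_const_mul' _ _ ENNReal.ofReal_ne_top,
          lintegral_const_mul' _ _ ENNReal.ofReal_ne_top]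
        ring
    _ ≤ _ := by
        rw [add_mul, one_mul]
        exact add_le_add (lintegral_mono fun η => mul_le_mul_left (hlow1 η) _)
          (mul_le_mul_right (lintegral_mono fun η => mul_le_mul_left (hlow2 η) _) _)

/-! ### From weighted estimates to bounded operators on the Sobolev space -/

theorem eLpNorm_le_of_lintegral_sq_le {α : Type*} [MeasurableSpace α] {μ : Measure α} {u v : α → ℂ}
    {C : ℝ≥0∞} (h : ∫⁻ x, ‖u x‖ₑ ^ 2 ∂μ ≤ C * ∫⁻ x, ‖v x‖ₑ ^ 2 ∂μ) :
    eLpNorm u 2 μ ≤ C ^ (1 / 2 : ℝ) * eLpNorm v 2 μ := by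
  rw [lintegral_sq_eq, lintegral_sq_eq] at h
  refine (ENNReal.pow_le_pow_left_iff two_ne_zero).1 (h.trans_eq ?_)
  rw [mul_pow, ← ENNReal.rpow_natCast (C ^ (1 / 2 : ℝ)), ← ENNReal.rpow_mul]
  norm_num

theorem Sobolev.two_pi_mul_norm {s : ℝ} (f : Sobolev s) :
    2 * π * ‖f‖ =
      (eLpNorm (fun p => (weight s p : ℂ) * fourierRT (Sobolev.toL2 s f) p) 2 dualMeasure).toReal := by
  rw [Sobolev.norm_def, ← norm_fourierRT, ← Lp.norm_toLp _ (Sobolev.memLp f)]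
  congr 1
  exact fourierRT.apply_symm_apply _

/-- Finiteness of the weighted integral gives membership in the space, and its size is the norm up
to the factor `2π` of the Fourier transform, which cancels. -/
theorem exists_sobolev_operator {s : ℝ} (A : L2RT →ₗ[ℂ] L2RT) {C : ℝ≥0∞} (hC : C ≠ ∞)
    (hA : ∀ f : L2RT, ∫⁻ p, ‖(weight s p : ℂ) * fourierRT (A f) p‖ₑ ^ 2 ∂dualMeasure ≤
        C * ∫⁻ p, ‖(weight s p : ℂ) * fourierRT f p‖ₑ ^ 2 ∂dualMeasure) :
    ∃ P : Sobolev s →L[ℂ] Sobolev s, ∀ f, Sobolev.toL2 s (P f) = A (Sobolev.toL2 s f) := by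
  have hn := fun f => eLpNorm_le_of_lintegral_sq_le (hA f)
  have hCtop : C ^ (1 / 2 : ℝ) ≠ ∞ := by finiteness
  have hmem : ∀ f : Sobolev s, A (Sobolev.toL2 s f) ∈ sobolevSubmodule s := fun f => by
    have hw := measurable_weight s
    have hm := (Lp.stronglyMeasurable (fourierRT (A (Sobolev.toL2 s f)))).measurable
    exact ⟨Measurable.aestronglyMeasurable (by fun_prop),
      (hn _).trans_lt (ENNReal.mul_lt_top hCtop.lt_top (Sobolev.memLp f).2)⟩
  let P₀ : Sobolev s →ₗ[ℂ] Sobolev s :=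
    { toFun := fun f => (⟨A (Sobolev.toL2 s f), hmem f⟩ : sobolevSubmodule s)
      map_add' := fun f g => Subtype.ext (by
        change A (Sobolev.toL2 s (f + g)) = A (Sobolev.toL2 s f) + A (Sobolev.toL2 s g)
        rw [map_add, map_add])
      map_smul' := fun c f => Subtype.ext (by
        change A (Sobolev.toL2 s (c • f)) = c • A (Sobolev.toL2 s f)
        rw [map_smul, map_smul]) }
  refine ⟨P₀.mkContinuous (C ^ (1 / 2 : ℝ)).toReal fun f => ?_, fun f => rfl⟩
  have h1 := Sobolev.two_pi_mul_norm (P₀ f)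
  have h2 := Sobolev.two_pi_mul_norm f
  have h3 := ENNReal.toReal_mono (ENNReal.mul_ne_top hCtop (Sobolev.memLp f).2.ne)
    (hn (Sobolev.toL2 s f))
  rw [ENNReal.toReal_mul, ← h2] at h3
  have h4 : 2 * π * ‖P₀ f‖ ≤ (C ^ (1 / 2 : ℝ)).toReal * (2 * π * ‖f‖) := h1.trans_le h3
  rw [mul_left_comm] at h4
  exact le_of_mul_le_mul_left h4 Real.two_pi_pos

end

end MellinFourier

theorem theorem5p2 (a : ℝ) (ha : Real.pi ≤ |a|) (s : ℝ) (hs0 : 0 ≤ s)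
    (hs : s < Real.pi / (2 * |a|)) :
    ∃ P : MellinFourier.Sobolev s →L[ℂ] MellinFourier.Sobolev s,
      ∀ f : MellinFourier.Sobolev s,
        MellinFourier.Sobolev.toL2 s (P f) =
          MellinFourier.opP a (MellinFourier.Sobolev.toL2 s f) := by
  have ha0 : 0 < |a| := Real.pi_pos.trans_le ha
  have h1 : |a| * s < Real.pi / 2 := by
    rw [lt_div_iff₀ (by positivity)] at hs
    linarith
  -- Here `|a| ≥ π` enters: `2|a| s < π ≤ |a|`.
  have h2 : s < 1 / 2 := by
    rw [lt_div_iff₀ (by positivity)] at hs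
    nlinarith [Real.pi_pos]
  obtain ⟨C, hC, h⟩ := MellinFourier.exists_weight_bound (a := a) hs0 h2 h1
  exact MellinFourier.exists_sobolev_operator (MellinFourier.opP a).toLinearMap hC h
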